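/- Let $M=(\mathcal S,\mathcal A,R,P,\mu_0,H)$ be an episodic MDP with finite state space, $|\mathcal S|=S$, finite action space, $|\mathcal A|=A$, and a fixed initial state ($\mu_0$ is a point mass), which is reset to the initial state after every $H$ steps. Let $p_{\min}$ be the smallest nonzero value of $P(s'\mid s,a)$, and let $D$ be the diameter: the largest, over all states $s$, of the length of a shortest path to $s$ from the initial state in the directed graph that has an edge $s\to s'$ whenever $P(s'\mid s,a)>0$ for some $a$. Assume that $D<H$. A learner in $\mathcal L$ holds a Q-table $Q_t\in\mathbb R^{\mathcal S\times\mathcal A}$. For some $\epsilon\in[0,1]$, at state $s$ it takes a greedy action $a^*\in\arg\max_a Q_t(s,a)$ (ties broken by any fixed rule) with probability $1-\epsilon$, and an action uniformly random in $\mathcal A\setminus\{a^*\}$ with probability $\epsilon$ (if $A=1$, it always takes the only action). It updates $Q_{t+1}=f(Q_t,(s_t,a_t,r_t,s_{t+1}))$, where only the entry $(s_t,a_t)$ changes and where, for all $Q_t,s_t,a_t,s_{t+1}$, there are rewards $r_t$ that make $a_t$ strictly first in $Q_{t+1}(s_t,\cdot)$, that make it strictly last, and that leave its rank unchanged. A Level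 4 teacher chooses every reward $r_t$ (knowing everything so far and $s_{t+1}$) but nothing else: actions are drawn by the learner, $s_{t+1}\sim P(\cdot\mid s_t,a_t)$, and initial states are drawn from $\mu_0$. A target policy $\pi^\dagger:\mathcal S\to\mathcal A$ is learned at the first time $T$ at which $\arg\max_a Q_T(s,a)=\{\pi^\dagger(s)\}$ for all $s$. NavTeach takes an initial state $s^S$ whose breadth-first tree in the transition graph has the smallest depth, takes such a tree rooted at $s^S$, and lists the states $s^1,\dots,s^S$ in a post-order depth-first traversal of it. For $i=1,\dots,S$, as long as $\arg\max_a Q_t(s^i,a)\ne\{\pi^\dagger(s^i)\}$, it rewards as follows. At $s_t=s^i$ it makes $a_t$ strictly first if $a_t=\pi^\dagger(s^i)$, and strictly last otherwise. At any other $s_t$ on the tree path from $s^S$ to $s^i$, with $s'$ the next state on that path, it makes $a_t$ strictly first if $P(s'\mid s_t,a_t)>0$, and strictly last otherwise. At all other $s_t$ it leaves the rank of $a_t$ unchanged. Then there is a universal constant $C$ such that, for every such $M$, every learner in $\mathcal L$, every $\pi^\dagger$ and every initial Q-table $Q_0$, where $Q_0(s,\cdot)$ has no ties for any $s$ in case $\epsilon>1-1/A$,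 NavTeach exists and, however its choices are made, it teaches $\pi^\dagger$ in an expected number of steps $$\mathbb E[T]\le C\,SAH\left(\frac1{p_{\min}(1-\epsilon)}\right)^D$$ (with $1/0=\infty$ and $\infty^0=1$). In particular, if $\epsilon\le 1-1/A$, the Level 4 teaching dimension $\mathrm{TDim}$ of the learner with respect to any family of such MDPs on $\mathcal S,\mathcal A$ with common $H$, $D$, $p_{\min}$, that is, the supremum over $M$, $Q_0$, $\pi^\dagger$ of the infimum of $\mathbb E[T]$ over all Level 4 teachers, is at most the same bound. -/

import Mathlib

open scoped ENNReal NNReal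

/-! ### Episodic Markov decision processes -/

/-- An episodic MDP `(S, A, R, P, μ₀, H)`; `P s a s'` is the probability `P(s' ∣ s, a)`. -/
structure MDP (S : Type*) (A : Type*) where
  R : S → A → ℝ
  P : S → A → PMF S
  μ₀ : PMF S
  H : ℕ

namespace MDP

variable {S : Type*} {A : Type*}

/-- The minimum transition probability: the least nonzero value of `P(s' ∣ s, a)`. -/
noncomputable def pMin (M : MDP S A) : ℝ≥0∞ :=
  ⨅ (s : S) (a : A) (s' : S) (_ : 0 < M.P s a s'), M.P s a s'

/-- The edges of the transition graph: transitions that some action supports. -/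
def Edge (M : MDP S A) (s s' : S) : Prop :=
  ∃ a, 0 < M.P s a s'

/-- There is a path with `T` transitions from `s` to `s'` in the transition graph. -/
def HasPath (M : MDP S A) (T : ℕ) (s s' : S) : Prop :=
  ∃ x : ℕ → S, x 0 = s ∧ x T = s' ∧ ∀ t < T, M.Edge (x t) (x (t + 1))

/-- The length of a shortest path from `s` to `s'` (`⊤` if there is none). -/
noncomputable def dist (M : MDP S A) (s s' : S) : ℕ∞ :=
  ⨅ (T : ℕ) (_ : M.HasPath T s s'), (T : ℕ∞)

/-- The diameter: the largest, over all states `s`, of the length of a shortest path that leads to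
`s` from a state `s₀` with `μ₀(s₀) > 0`. -/
noncomputable def diameter (M : MDP S A) : ℕ∞ :=
  ⨆ s : S, ⨅ (s₀ : S) (_ : 0 < M.μ₀ s₀), M.dist s₀ s

end MDP

/-! ### The learners -/

/-- Q-tables. -/
abbrev QTable (S : Type*) (A : Type*) := S → A → ℝ

/-- The three things that a reward may be asked to do with the rank of the chosen action. -/
inductive Signal
  | promote
  | demote
  | maintain

/-- `Reranks g q q' a`: passing from the row `q` to the row `q'` of a Q-table makes `a` strictly
first, makes `a` strictly last, or leaves its rank as it was, according to the signal `g`. -/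
def Reranks {A : Type*} (g : Signal) (q q' : A → ℝ) (a : A) : Prop :=
  match g with
  | .promote => ∀ b, b ≠ a → q' b < q' a
  | .demote => ∀ b, b ≠ a → q' a < q' b
  | .maintain => ∀ b, b ≠ a → ((q' a < q' b ↔ q a < q b) ∧ (q' b < q' a ↔ q b < q a))

/-- The family of learners: `ε`-greedy behaviour, with any rule `greedy` for selecting a maximal
action, and a controllable update `Q_{t+1} = f(Q_t, (s, a, r, s'))` that touches only the entry
`(s, a)`. -/
structure QLearner (S : Type*) (A : Type*) where
  ε : ℝ≥0
  ε_le_one : ε ≤ 1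
  greedy : QTable S A → S → A
  greedy_max : ∀ (Q : QTable S A) (s : S) (b : A), Q s b ≤ Q s (greedy Q s)
  update : QTable S A → S → A → ℝ → S → QTable S A
  update_other : ∀ (Q : QTable S A) (s : S) (a : A) (r : ℝ) (s' x : S) (b : A),
    (x, b) ≠ (s, a) → update Q s a r s' x b = Q x b
  controllable : ∀ (g : Signal) (Q : QTable S A) (s : S) (a : A) (s' : S), ∃ r, Reranks g (Q s) (update Q s a r s' s) a

open Classical in
/-- The `ε`-greedy probability of the action `a` when `a₀` is the greedy action: `1 - ε` for `a₀`
and `ε / (|A| - 1)` for every other action (and `1` if there is only one action). -/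
noncomputable def epsGreedyWeight {A : Type*} [Fintype A] (ε : ℝ≥0) (a₀ a : A) : ℝ≥0∞ :=
  if Fintype.card A = 1 then 1
  else if a = a₀ then 1 - (ε : ℝ≥0∞)
  else (ε : ℝ≥0∞) / ((Fintype.card A - 1 : ℕ) : ℝ≥0∞)

lemma sum_epsGreedyWeight {A : Type*} [Fintype A] {ε : ℝ≥0} (hε : ε ≤ 1) (a₀ : A) :
    ∑ a, epsGreedyWeight ε a₀ a = 1 := by
  classical
  unfold epsGreedyWeight
  by_cases h : Fintype.card A = 1
  · simp [h]
  · have hpos : 0 < Fintype.card A := Fintype.card_pos_iff.mpr ⟨a₀⟩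
    have hne : ((Fintype.card A - 1 : ℕ) : ℝ≥0∞) ≠ 0 := by
      have : Fintype.card A - 1 ≠ 0 := by omega
      exact_mod_cast this
    rw [← Finset.add_sum_erase _ _ (Finset.mem_univ a₀)]
    have hsum : ∑ a ∈ Finset.univ.erase a₀,
        (if Fintype.card A = 1 then (1 : ℝ≥0∞) else if a = a₀ then 1 - (ε : ℝ≥0∞)
          else (ε : ℝ≥0∞) / ((Fintype.card A - 1 : ℕ) : ℝ≥0∞)) = ε := by
      rw [Finset.sum_congr rfl (g := fun _ =>
        (ε : ℝ≥0∞) / ((Fintype.card A - 1 : ℕ) : ℝ≥0∞))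
        (fun a ha => by simp [h, Finset.ne_of_mem_erase ha])]
      rw [Finset.sum_const, Finset.card_erase_of_mem (Finset.mem_univ a₀), Finset.card_univ,
        nsmul_eq_mul]
      exact ENNReal.mul_div_cancel hne (ENNReal.natCast_ne_top _)
    rw [hsum]
    simp only [h, if_false, if_true]
    exact tsub_add_cancel_of_le (by exact_mod_cast hε)

/-- The behaviour policy of the learner with the given Q-table: `ε`-greedy. -/
noncomputable def QLearner.policy {S : Type*} {A : Type*} [Fintype A] (L : QLearner S A)
    (Q : QTable S A) (s : S) : PMF A :=
  PMF.ofFintype (epsGreedyWeight L.ε (L.greedy Q s)) (sum_epsGreedyWeight L.ε_le_one _)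

/-- The action `a` is the only maximiser of the row of `s`: `argmax Q(s, ·) = {a}`. -/
def TaughtAt {S : Type*} {A : Type*} (Q : QTable S A) (s : S) (a : A) : Prop :=
  ∀ b, b ≠ a → Q s b < Q s a

/-- The greedy policy of the Q-table is, unambiguously, the policy `π`. -/
def Taught {S : Type*} {A : Type*} (Q : QTable S A) (π : S → A) : Prop :=
  ∀ s, TaughtAt Q s (π s)

/-! ### Teaching by choosing the rewards (level 4) -/

/-- The experiences `(s, a, r, s')` so far, the latest one first. -/
abbrev Hist (S : Type*) (A : Type*) := List (S × A × ℝ × S)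

/-- A level 4 teacher: it chooses only the reward, from all that has happened, the current state
and action, and the next state (which is sampled from the MDP). -/
abbrev Teacher (S : Type*) (A : Type*) := Hist S A → S → A → S → ℝ

/-- The Q-table of the learner after the given experiences. -/
def QLearner.table {S : Type*} {A : Type*} (L : QLearner S A) (Q₀ : QTable S A) :
    Hist S A → QTable S A
  | [] => Q₀
  | (s, a, r, s') :: h => L.update (L.table Q₀ h) s a r s'

section Protocol

variable {S : Type*} {A : Type*} [Fintype A]

open Classical in
/-- One step of the teaching protocol from a history and a current state.  Teaching is over, and
nothing happens any more, once the target policy is learned.  Otherwise `a ∼ π_t(s)` and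
`s' ∼ P(· ∣ s, a)`, the teacher chooses the reward, the experience is recorded (and so the learner
updates), and after every `H` steps the MDP is reset to a state drawn from `μ₀`. -/
noncomputable def teachStep (M : MDP S A) (L : QLearner S A) (Q₀ : QTable S A) (π : S → A)
    (T : Teacher S A) (c : Hist S A × S) : PMF (Hist S A × S) :=
  if Taught (L.table Q₀ c.1) π then PMF.pure c
  else
    (L.policy (L.table Q₀ c.1) c.2).bind fun a =>
      (M.P c.2 a).bind fun s' =>
        if (c.1.length + 1) % M.H = 0 then
          M.μ₀.map fun s₀ => ((c.2, a, T c.1 c.2 a s', s') :: c.1, s₀)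
        else PMF.pure ((c.2, a, T c.1 c.2 a s', s') :: c.1, s')

/-- The law of the history and the current state after at most `n` steps of teaching. -/
noncomputable def teachLaw (M : MDP S A) (L : QLearner S A) (Q₀ : QTable S A) (π : S → A)
    (T : Teacher S A) : ℕ → PMF (Hist S A × S)
  | 0 => M.μ₀.map fun s₀ => ([], s₀)
  | n + 1 => (teachLaw M L Q₀ π T n).bind (teachStep M L Q₀ π T)

/-- The expected number of teaching steps until the target policy is learned: the sum over `n` of
the probability that the step with index `n` still has to be made. -/
noncomputable def expectedSteps (M : MDP S A) (L : QLearner S A) (Q₀ : QTable S A) (π : S → A)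
    (T : Teacher S A) : ℝ≥0∞ :=
  ∑' n : ℕ, (teachLaw M L Q₀ π T n).toOuterMeasure {c | ¬ Taught (L.table Q₀ c.1) π}

/-- The minimum expected teaching length of an instance, over all level 4 teachers. -/
noncomputable def METaL (M : MDP S A) (L : QLearner S A) (Q₀ : QTable S A) (π : S → A) : ℝ≥0∞ :=
  ⨅ T : Teacher S A, expectedSteps M L Q₀ π T

/-- The (level 4) teaching dimension of a learner with respect to a family of MDPs. -/
noncomputable def TDim (L : QLearner S A) (𝓜 : Set (MDP S A)) : ℝ≥0∞ :=
  ⨆ (M : MDP S A) (_ : M ∈ 𝓜) (Q₀ : QTable S A) (π : S → A), METaL M L Q₀ π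

end Protocol

/-! ### The NavTeach algorithm -/

/-- `IsPostOrder parent root v l`: the list `l` is a post-order depth-first traversal of the
subtree of `v`, in the tree with the given root and parent map: the traversals of the subtrees of
the children of `v`, one after the other in some order, and then `v`. -/
inductive IsPostOrder {S : Type*} (parent : S → S) (root : S) : S → List S → Prop
  | node (v : S) (children : List S) (ls : List (List S)) (nodup : children.Nodup)
      (mem_children : ∀ c, c ∈ children ↔ c ≠ root ∧ parent c = v)
      (sub : List.Forall₂ (IsPostOrder parent root) children ls) :
      IsPostOrder parent root v (ls.flatten ++ [v])

/-- The choices made by NavTeach: an initial state as the root (one with the smallest depth of its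
breadth-first tree), a breadth-first tree of the transition graph, given by its parent map, a
post-order depth-first traversal of the tree, and for each request a reward that fulfils it. -/
structure NavTeach {S : Type*} {A : Type*} (M : MDP S A) (L : QLearner S A) where
  root : S
  root_mem : 0 < M.μ₀ root
  root_min : ∀ s, 0 < M.μ₀ s → ⨆ x, M.dist root x ≤ ⨆ x, M.dist s x
  parent : S → S
  parent_root : parent root = root
  parent_edge : ∀ v, v ≠ root → M.Edge (parent v) v
  parent_dist : ∀ v, v ≠ root → M.dist root v = M.dist root (parent v) + 1
  order : List S
  order_post : IsPostOrder parent root root order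
  carrotStick : Signal → QTable S A → S → A → S → ℝ
  carrotStick_spec : ∀ (g : Signal) (Q : QTable S A) (s : S) (a : A) (s' : S),
    Reranks g (Q s) (L.update Q s a (carrotStick g Q s a s') s' s) a

namespace NavTeach

variable {S : Type*} {A : Type*} {M : MDP S A} {L : QLearner S A}

/-- The state `s` lies on the ancestral path from the root to `g`. -/
def OnPath (N : NavTeach M L) (g s : S) : Prop :=
  ∃ k : ℕ, N.parent^[k] g = s

/-- The state `c` comes right after `s` on the ancestral path from the root to `g`. -/
def IsNext (N : NavTeach M L) (g s c : S) : Prop :=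
  c ≠ N.root ∧ N.parent c = s ∧ N.OnPath g c

open Classical in
/-- What NavTeach does with the action `a` at the state `s` while it teaches the state `g`. -/
noncomputable def signal (N : NavTeach M L) (π : S → A) (g s : S) (a : A) : Signal :=
  if s = g then
    if a = π s then .promote else .demote
  else if N.OnPath g s then
    if ∃ c, N.IsNext g s c ∧ 0 < M.P s a c then .promote else .demote
  else .maintain

open Classical in
/-- The subtasks that are not completed yet; the first one is the current subtask.  A subtask is
left as soon as its state is taught, and is never taken up again. -/
noncomputable def pending (N : NavTeach M L) (Q₀ : QTable S A) (π : S → A) : Hist S A → List S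
  | [] => N.order.dropWhile fun g => decide (TaughtAt Q₀ g (π g))
  | e :: h => (N.pending Q₀ π h).dropWhile fun g =>
      decide (TaughtAt (L.table Q₀ (e :: h)) g (π g))

/-- NavTeach as a level 4 teacher. -/
noncomputable def teacher (N : NavTeach M L) (Q₀ : QTable S A) (π : S → A) : Teacher S A :=
  fun h s a s' =>
    match N.pending Q₀ π h with
    | [] => N.carrotStick .maintain (L.table Q₀ h) s a s'
    | g :: _ => N.carrotStick (N.signal π g s a) (L.table Q₀ h) s a s'

end NavTeach

/-!
The proof exhibits a Lyapunov function: a function `V` of the history and the current state that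
drops by at least one in expectation at every step, so that its initial value bounds the expected
number of steps (`tsum_toOuterMeasure_le_of_drift`).

The subtasks split into at most `2 |S|` jobs that each concern one row of the Q-table and one set
`G` of actions: to bring the target action of a state `c` to the top, and to bring an action that
can lead from the parent of `c` to `c` above all actions that cannot.  In both cases NavTeach
promotes the actions in `G` and demotes the others.  The work left in a row (`rowWork`) is at most
`|A|` and never grows, and a visit at which the job still matters lowers it in expectation by at
least `1 / 2` (`exists_rowWork_drop`): a learner with `ε < 1 / 2` chooses its greedy action with
probability at least `1 / 2`, which removes an obstacle or promotes, and any other learner chooses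
an action of `G` with probability at least `1 / (2 |A|)`.  If `ε > 1 - 1 / |A|`, this can only fail
at a greedy target action that is tied with another one, which the absence of ties excludes.

The `potential` is the work left in all jobs that are not completed.  It is at most `2 |S| |A|`.  It
does not grow when a subtask ends (`potential_suffix`), because every subtree is a contiguous block
of a post-order traversal (`IsPostOrder.mem_nodup_blocks`): the navigation to `c` is in use during
one block of subtasks, and its work is counted in full before that.  Nor do subtasks spoil each
other, as the ancestors of a state come later in the traversal.

Let `q = p_min (1 - ε)`.  In every episode the learner follows with probability at least `q ^ D` the
tree path down to the first state whose greedy action does not navigate, or to the goal, and this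
happens before the reset since `D < H`.  There the potential drops in expectation by `1 / 2`.  So an
episode lowers the potential by `q ^ D / 2` on average.  The function `lyapunov` spreads this drop
over the steps of an episode, by means of the `chance` that it will still come: every step turns
chance into potential drop or into the chance of the next state (`chance_le_sum_gain`).  In total
this takes at most `(2 |S| |A|) * (2 H / q ^ D)` steps.
-/

/-! ### A drift criterion for the expected number of steps -/

lemma PMF.tsum_bind_mul {α β : Type*} (p : PMF α) (f : α → PMF β) (V : β → ℝ≥0∞) :
    ∑' b, p.bind f b * V b = ∑' a, p a * ∑' b, f a b * V b := by
  simp_rw [PMF.bind_apply, ← ENNReal.tsum_mul_right, ← ENNReal.tsum_mul_left, mul_assoc]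
  exact ENNReal.tsum_comm

lemma PMF.tsum_pure_mul {α : Type*} (a : α) (V : α → ℝ≥0∞) :
    ∑' b, PMF.pure a b * V b = V a := by
  classical
  rw [tsum_eq_single a (fun b hb => by simp [PMF.pure_apply, hb])]
  simp [PMF.pure_apply]

/-- Foster–Lyapunov criterion: if `V` drops by at least one in expectation at every step made
from `B`, and does not grow in expectation elsewhere, then the expected number of visits to `B` is
at most the expectation of `V` under the initial law. -/
lemma tsum_toOuterMeasure_le_of_drift {α : Type*} (law : ℕ → PMF α) (step : α → PMF α)
    (hlaw : ∀ n, law (n + 1) = (law n).bind step) (B : Set α) (V : α → ℝ≥0∞)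
    (hB : ∀ c ∈ B, 1 + ∑' c', step c c' * V c' ≤ V c)
    (hBc : ∀ c ∉ B, ∑' c', step c c' * V c' ≤ V c) :
    ∑' n, (law n).toOuterMeasure B ≤ ∑' c, law 0 c * V c := by
  classical
  have key : ∀ N : ℕ, ∑ n ∈ Finset.range N, (law n).toOuterMeasure B + ∑' c, law N c * V c
      ≤ ∑' c, law 0 c * V c := by
    intro N
    induction N with
    | zero => simp
    | succ N ih =>
      refine le_trans ?_ ih
      rw [Finset.sum_range_succ, add_assoc, hlaw, PMF.tsum_bind_mul, PMF.toOuterMeasure_apply,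
        ← ENNReal.tsum_add]
      gcongr with c
      by_cases hc : c ∈ B
      · rw [Set.indicator_of_mem hc]
        calc law N c + law N c * ∑' c', step c c' * V c'
            = law N c * (1 + ∑' c', step c c' * V c') := by ring
          _ ≤ _ := by gcongr; exact hB c hc
      · rw [Set.indicator_of_notMem hc, zero_add]
        gcongr
        exact hBc c hc
  rw [ENNReal.tsum_eq_iSup_nat]
  exact iSup_le fun N => le_trans le_self_add (key N)

lemma PMF.sum_toReal {α : Type*} [Fintype α] (p : PMF α) : ∑ a, (p a).toReal = 1 := by
  rw [← ENNReal.toReal_sum (fun a _ => p.apply_ne_top a), ← tsum_fintype (L := .unconditional _),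
    p.tsum_coe, ENNReal.toReal_one]

lemma PMF.tsum_mul_ofReal {α : Type*} [Fintype α] (p : PMF α) (f : α → ℝ) (hf : ∀ a, 0 ≤ f a) :
    ∑' a, p a * ENNReal.ofReal (f a) = ENNReal.ofReal (∑ a, (p a).toReal * f a) := by
  rw [tsum_fintype, ENNReal.ofReal_sum_of_nonneg
    (fun a _ => mul_nonneg ENNReal.toReal_nonneg (hf a))]
  refine Finset.sum_congr rfl fun a _ => ?_
  rw [ENNReal.ofReal_mul ENNReal.toReal_nonneg, ENNReal.ofReal_toReal (p.apply_ne_top a)]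

/-! ### Teaching one row of the Q-table -/

section Row

variable {A : Type*}

lemma injective_of_reranks {g : Signal} {q q' : A → ℝ} {a : A} (hq : Function.Injective q)
    (ho : ∀ b, b ≠ a → q' b = q b) (h : Reranks g q q' a) : Function.Injective q' := by
  have key : ∀ b, b ≠ a → q' b ≠ q' a := by
    intro b hb
    cases g with
    | promote => exact (h b hb).ne
    | demote => exact (h b hb).ne'
    | maintain =>
      rcases lt_or_gt_of_ne (hq.ne hb) with hlt | hlt
      · exact ((h b hb).2.mpr hlt).ne
      · exact ((h b hb).1.mpr hlt).ne'
  intro b c hbc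
  by_contra hne
  by_cases hb : b = a
  · subst hb
    exact key c (Ne.symm hne) hbc.symm
  · by_cases hc : c = a
    · subst hc
      exact key b hb hbc
    · rw [ho b hb, ho c hc] at hbc
      exact hne (hq hbc)

lemma isMax_of_maintain {q q' : A → ℝ} {a t : A} (ho : ∀ b, b ≠ a → q' b = q b)
    (h : Reranks Signal.maintain q q' a) (ht : ∀ b, b ≠ t → q b < q t) :
    ∀ b, b ≠ t → q' b < q' t := by
  intro b hb
  by_cases hta : t = a
  · subst hta
    exact (h b hb).2.mpr (ht b hb)
  · by_cases hba : b = a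
    · subst hba
      exact (h t hta).1.mpr (ht b hb)
    · rw [ho b hba, ho t hta]
      exact ht b hb

variable [Fintype A]

open Classical in
/-- The obstacles to a set `G` of desired actions: the other actions whose value is at least that
of every action in `G`.  If there are none, then every maximal action lies in `G`. -/
noncomputable def obstacles (G : Set A) (q : A → ℝ) : Finset A :=
  Finset.univ.filter fun b => b ∉ G ∧ ∀ a ∈ G, q a ≤ q b

open Classical in
/-- The work left until the actions in `G` come first in the row `q`.  A learner that mostly acts
greedily removes the obstacles one by one, so they are counted; a learner that mostly explores
hits upon an action in `G` by itself, so there only the existence of an obstacle matters. -/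
noncomputable def rowWork (ε : ℝ≥0) (G : Set A) (q : A → ℝ) : ℕ :=
  if ε < 1 / 2 then (obstacles G q).card
  else if obstacles G q = ∅ then 0 else Fintype.card A

open Classical in
/-- The row `q'` arises from the row `q` when the value of `a` alone changes, `a` being promoted if
it lies in `G` and demoted otherwise. -/
def Rewards (G : Set A) (a : A) (q q' : A → ℝ) : Prop :=
  (∀ b, b ≠ a → q' b = q b) ∧ Reranks (if a ∈ G then Signal.promote else Signal.demote) q q' a

lemma mem_obstacles {G : Set A} {q : A → ℝ} {b : A} :
    b ∈ obstacles G q ↔ b ∉ G ∧ ∀ a ∈ G, q a ≤ q b := by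
  simp [obstacles]

lemma rowWork_le (ε : ℝ≥0) (G : Set A) (q : A → ℝ) : rowWork ε G q ≤ Fintype.card A := by
  unfold rowWork
  split_ifs
  · exact Finset.card_le_univ _
  · exact Nat.zero_le _
  · exact le_rfl

lemma rowWork_mono (ε : ℝ≥0) {G : Set A} {q q' : A → ℝ} (h : obstacles G q' ⊆ obstacles G q) :
    rowWork ε G q' ≤ rowWork ε G q := by
  unfold rowWork
  split_ifs with h1 h2 h3 h3
  · exact Finset.card_le_card h
  · exact le_rfl
  · exact Nat.zero_le _
  · rw [h3] at h
    exact absurd (Finset.subset_empty.mp h) h2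
  · exact le_rfl

open Classical in
lemma Rewards.obstacles_subset {G : Set A} (hG : G.Nonempty) {a : A} {q q' : A → ℝ}
    (h : Rewards G a q q') : obstacles G q' ⊆ (obstacles G q).erase a := by
  classical
  obtain ⟨h1, h2⟩ := h
  intro b hb
  rw [mem_obstacles] at hb
  by_cases ha : a ∈ G
  · rw [if_pos ha] at h2
    exact absurd (h2 b fun e => hb.1 (e ▸ ha)) (not_lt.mpr (hb.2 a ha))
  · rw [if_neg ha] at h2
    have hba : b ≠ a := by
      rintro rfl
      obtain ⟨g, hg⟩ := hG
      exact absurd (h2 g fun e => ha (e ▸ hg)) (not_lt.mpr (hb.2 g hg))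
    refine Finset.mem_erase.mpr ⟨hba, mem_obstacles.mpr ⟨hb.1, fun g hg => ?_⟩⟩
    rw [← h1 g fun e => ha (e ▸ hg), ← h1 b hba]
    exact hb.2 g hg

lemma Rewards.obstacles_eq_empty {G : Set A} {a : A} (ha : a ∈ G) {q q' : A → ℝ}
    (h : Rewards G a q q') : obstacles G q' = ∅ := by
  classical
  have h2 := h.2
  rw [if_pos ha] at h2
  refine Finset.eq_empty_of_forall_notMem fun b hb => ?_
  rw [mem_obstacles] at hb
  exact absurd (h2 b fun e => hb.1 (e ▸ ha)) (not_lt.mpr (hb.2 a ha))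

lemma Rewards.rowWork_le (ε : ℝ≥0) {G : Set A} (hG : G.Nonempty) {a : A} {q q' : A → ℝ}
    (h : Rewards G a q q') : rowWork ε G q' ≤ rowWork ε G q := by
  classical
  exact rowWork_mono ε ((h.obstacles_subset hG).trans (Finset.erase_subset _ _))

/-- While there is an obstacle, one visit of the learner removes in expectation at least `1 / 2`
from the work, through some action alone.  For small `ε` this is the greedy action, and for large
`ε` an action in `G`, which is promoted.  The second hypothesis excludes the one bad
case: an action in `G` that is greedy through a tie, while exploration is too frequent. -/
lemma exists_rowWork_drop {ε : ℝ≥0} (hε : ε ≤ 1) {G : Set A} (hG : G.Nonempty) {q : A → ℝ}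
    {a₀ : A} (hmax : ∀ b, q b ≤ q a₀) (hobs : (obstacles G q).Nonempty)
    (htie : (ε : ℝ) ≤ 1 - 1 / (Fintype.card A : ℝ) ∨ a₀ ∉ G) :
    ∃ (a : A) (δ : ℕ), 1 / 2 ≤ (epsGreedyWeight ε a₀ a).toReal * δ ∧
      ∀ q', Rewards G a q q' → rowWork ε G q' + δ ≤ rowWork ε G q := by
  classical
  obtain ⟨g, hg⟩ := hG
  obtain ⟨b, hb⟩ := hobs
  have hgb : g ≠ b := fun e => (mem_obstacles.mp hb).1 (e ▸ hg)
  have hcard : 1 < Fintype.card A := Fintype.one_lt_card_iff.mpr ⟨g, b, hgb⟩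
  have hcR : (1 : ℝ) < Fintype.card A := by exact_mod_cast hcard
  have hεR : (ε : ℝ) ≤ 1 := by exact_mod_cast hε
  have hw₀ : (epsGreedyWeight ε a₀ a₀).toReal = 1 - ε := by
    rw [epsGreedyWeight, if_neg hcard.ne', if_pos rfl,
      ENNReal.toReal_sub_of_le (by exact_mod_cast hε) ENNReal.one_ne_top]
    simp
  have hw : ∀ a, a ≠ a₀ → (epsGreedyWeight ε a₀ a).toReal = ε / (Fintype.card A - 1) := by
    intro a ha
    rw [epsGreedyWeight, if_neg hcard.ne', if_neg ha, ENNReal.toReal_div, ENNReal.toReal_natCast,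
      Nat.cast_sub hcard.le, Nat.cast_one, ENNReal.coe_toReal]
  have hne : obstacles G q ≠ ∅ := Finset.ne_empty_of_mem hb
  by_cases hs : ε < 1 / 2
  · have hsR : (ε : ℝ) < 1 / 2 := by exact_mod_cast hs
    refine ⟨a₀, 1, by rw [hw₀, Nat.cast_one]; linarith, fun q' h => ?_⟩
    rw [rowWork, rowWork, if_pos hs, if_pos hs]
    by_cases ha : a₀ ∈ G
    · rw [h.obstacles_eq_empty ha]
      simpa using Finset.card_pos.mpr ⟨b, hb⟩
    · have hmem : a₀ ∈ obstacles G q := mem_obstacles.mpr ⟨ha, fun a _ => hmax a⟩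
      have := Finset.card_le_card (h.obstacles_subset ⟨g, hg⟩)
      rw [Finset.card_erase_of_mem hmem] at this
      have := Finset.card_pos.mpr ⟨b, hb⟩
      omega
  · have hsR : (1 / 2 : ℝ) ≤ ε := by exact_mod_cast not_lt.mp hs
    have hdrop : ∀ a ∈ G, ∀ q', Rewards G a q q' →
        rowWork ε G q' + Fintype.card A ≤ rowWork ε G q := fun a ha q' h => by
      rw [rowWork, rowWork, if_neg hs, if_neg hs, if_neg hne, if_pos (h.obstacles_eq_empty ha),
        zero_add]
    by_cases ha : a₀ ∈ G
    · refine ⟨a₀, Fintype.card A, ?_, hdrop a₀ ha⟩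
      have h1 := htie.resolve_right (not_not.mpr ha)
      rw [hw₀]
      have h2 : 1 / (Fintype.card A : ℝ) * Fintype.card A = 1 := by field_simp
      nlinarith
    · refine ⟨g, Fintype.card A, ?_, hdrop g hg⟩
      rw [hw g fun e => ha (e ▸ hg), div_mul_eq_mul_div, le_div_iff₀ (by linarith)]
      nlinarith

lemma obstacles_singleton_nonempty {q : A → ℝ} {a : A} (h : ¬ ∀ b, b ≠ a → q b < q a) :
    (obstacles {a} q).Nonempty := by
  push Not at h
  obtain ⟨b, hb, hle⟩ := h
  exact ⟨b, mem_obstacles.mpr ⟨hb, by simpa using hle⟩⟩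

lemma one_sub_le_epsGreedyWeight (ε : ℝ≥0) (a₀ : A) :
    1 - (ε : ℝ≥0∞) ≤ epsGreedyWeight ε a₀ a₀ := by
  unfold epsGreedyWeight
  split_ifs
  · exact tsub_le_self
  · exact le_rfl
  · contradiction

end Row

/-! ### Post-order traversals -/

section PostOrder

variable {S : Type*} {parent : S → S} {root : S} {depth : S → ℕ}

/-- `Desc parent x v`: the state `x` lies in the subtree of `v`. -/
def Desc (parent : S → S) (x v : S) : Prop :=
  ∃ k : ℕ, parent^[k] x = v

lemma Desc.refl (parent : S → S) (x : S) : Desc parent x x := ⟨0, rfl⟩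

lemma Desc.trans {x y z : S} (h₁ : Desc parent x y) (h₂ : Desc parent y z) : Desc parent x z := by
  obtain ⟨k, rfl⟩ := h₁
  obtain ⟨l, rfl⟩ := h₂
  exact ⟨l + k, Function.iterate_add_apply ..⟩

lemma Desc.to_parent {x c : S} (h : Desc parent x c) : Desc parent x (parent c) :=
  h.trans ⟨1, rfl⟩

lemma Desc.total {x y z : S} (h₁ : Desc parent x y) (h₂ : Desc parent x z) :
    Desc parent y z ∨ Desc parent z y := by
  obtain ⟨k, rfl⟩ := h₁
  obtain ⟨l, rfl⟩ := h₂
  rcases le_total k l with h | h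
  · exact .inl ⟨l - k, by rw [← Function.iterate_add_apply, Nat.sub_add_cancel h]⟩
  · exact .inr ⟨k - l, by rw [← Function.iterate_add_apply, Nat.sub_add_cancel h]⟩

/-- A proper ancestor is less deep. -/
lemma Desc.eq_or_depth_lt (hroot : parent root = root)
    (hdepth : ∀ v, v ≠ root → depth v = depth (parent v) + 1) {x v : S} (h : Desc parent x v) :
    x = v ∨ depth v < depth x := by
  obtain ⟨k, rfl⟩ := h
  induction k with
  | zero => exact .inl rfl
  | succ k ih =>
    rw [Function.iterate_succ_apply']
    by_cases hr : parent^[k] x = root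
    · rw [hr, hroot, ← hr]
      exact ih
    · have := hdepth _ hr
      rcases ih with h | h
      · rw [← h] at this ⊢
        omega
      · omega

lemma Desc.depth_le (hroot : parent root = root)
    (hdepth : ∀ v, v ≠ root → depth v = depth (parent v) + 1) {x v : S} (h : Desc parent x v) :
    depth v ≤ depth x := by
  rcases h.eq_or_depth_lt hroot hdepth with h | h
  · rw [h]
  · exact h.le

/-- The subtrees of two siblings are disjoint. -/
lemma Desc.sibling_unique (hroot : parent root = root)
    (hdepth : ∀ v, v ≠ root → depth v = depth (parent v) + 1) {x c c' : S} (h : Desc parent x c)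
    (h' : Desc parent x c') (hc : c ≠ root) (hc' : c' ≠ root) (hp : parent c = parent c') :
    c = c' := by
  have h1 := hdepth c hc
  have h2 := hdepth c' hc'
  rw [hp] at h1
  rcases h.total h' with h | h <;> rcases h.eq_or_depth_lt hroot hdepth with h | h
  · exact h
  · omega
  · exact h.symm
  · omega

lemma desc_root (hdepth : ∀ v, v ≠ root → depth v = depth (parent v) + 1) (x : S) :
    Desc parent x root := by
  induction hn : depth x generalizing x with
  | zero =>
    by_cases hx : x = root
    · exact hx ▸ Desc.refl parent x
    · have := hdepth x hx
      omega
  | succ n ih =>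
    by_cases hx : x = root
    · exact hx ▸ Desc.refl parent x
    · have := hdepth x hx
      exact Desc.trans ⟨1, rfl⟩ (ih (parent x) (by omega))

/-- Every subtree that meets the list occupies a contiguous block of it, and its root comes at the
end of the block. -/
def Blocks (parent : S → S) (l : List S) : Prop :=
  ∀ c ∈ l, ∃ l₁ l₂ l₃ : List S, l = l₁ ++ (l₂ ++ c :: l₃) ∧
    (∀ x ∈ l₁, ¬ Desc parent x c) ∧ (∀ x ∈ l₂, Desc parent x c) ∧ ∀ x ∈ l₃, ¬ Desc parent x c

/-- The concatenation of traversals of the subtrees of siblings. -/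
lemma blocks_flatten (hroot : parent root = root)
    (hdepth : ∀ v, v ≠ root → depth v = depth (parent v) + 1) {v : S} {children : List S}
    {ls : List (List S)} (nodup : children.Nodup)
    (hchildren : ∀ c ∈ children, c ≠ root ∧ parent c = v)
    (h : List.Forall₂ (fun c l => (∀ x, x ∈ l ↔ Desc parent x c) ∧ l.Nodup ∧ Blocks parent l)
      children ls) :
    (∀ x, x ∈ ls.flatten ↔ ∃ c ∈ children, Desc parent x c) ∧ ls.flatten.Nodup ∧
      Blocks parent ls.flatten := by
  induction h with
  | nil => simp [Blocks]
  | @cons c l cs ls hl hls ih =>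
    obtain ⟨hmem, hnd, hbl⟩ := hl
    rw [List.nodup_cons] at nodup
    obtain ⟨ihmem, ihnd, ihbl⟩ := ih nodup.2 fun c hc => hchildren c (List.mem_cons_of_mem _ hc)
    have hc := hchildren c List.mem_cons_self
    have hdisj : ∀ x, Desc parent x c → ∀ c' ∈ cs, ¬ Desc parent x c' := by
      intro x hx c' hc' hx'
      have h' := hchildren c' (List.mem_cons_of_mem _ hc')
      have := hx.sibling_unique hroot hdepth hx' hc.1 h'.1 (hc.2.trans h'.2.symm)
      exact nodup.1 (this ▸ hc')
    rw [List.flatten_cons]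
    refine ⟨fun x => by simp [hmem, ihmem], ?_, fun y hy => ?_⟩
    · refine hnd.append ihnd fun x hx hx' => ?_
      obtain ⟨c', hc', hd⟩ := (ihmem x).mp hx'
      exact hdisj x ((hmem x).mp hx) c' hc' hd
    · rcases List.mem_append.mp hy with hy | hy
      · obtain ⟨l₁, l₂, l₃, rfl, h₁, h₂, h₃⟩ := hbl y hy
        refine ⟨l₁, l₂, l₃ ++ ls.flatten, by simp, h₁, h₂, fun x hx hd => ?_⟩
        rcases List.mem_append.mp hx with hx | hx
        · exact h₃ x hx hd
        · obtain ⟨c', hc', hd'⟩ := (ihmem x).mp hx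
          exact hdisj x (hd.trans ((hmem y).mp hy)) c' hc' hd'
      · obtain ⟨l₁, l₂, l₃, heq, h₁, h₂, h₃⟩ := ihbl y hy
        refine ⟨l ++ l₁, l₂, l₃, by rw [heq]; simp, fun x hx hd => ?_, h₂, h₃⟩
        rcases List.mem_append.mp hx with hx | hx
        · obtain ⟨c', hc', hd'⟩ := (ihmem y).mp hy
          exact hdisj x ((hmem x).mp hx) c' hc' (hd.trans hd')
        · exact h₁ x hx hd

lemma IsPostOrder.mem_nodup_blocks (hroot : parent root = root)
    (hdepth : ∀ v, v ≠ root → depth v = depth (parent v) + 1) {v : S} {l : List S}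
    (h : IsPostOrder parent root v l) :
    (∀ x, x ∈ l ↔ Desc parent x v) ∧ l.Nodup ∧ Blocks parent l := by
  induction hn : l.length using Nat.strong_induction_on generalizing v l with
  | _ n ih =>
    obtain ⟨_, children, ls, nodup, hchildren, sub⟩ := h
    have sub' : List.Forall₂ (fun c l => (∀ x, x ∈ l ↔ Desc parent x c) ∧ l.Nodup ∧
        Blocks parent l) children ls := by
      rw [List.forall₂_iff_get] at sub ⊢
      refine ⟨sub.1, fun i h₁ h₂ => ih _ ?_ (sub.2 i h₁ h₂) rfl⟩
      have : (ls.get ⟨i, h₂⟩).length ≤ ls.flatten.length :=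
        (List.sublist_flatten_of_mem (List.get_mem ..)).length_le
      rw [← hn, List.length_append, List.length_singleton]
      omega
    obtain ⟨hmem, hnd, hbl⟩ := blocks_flatten hroot hdepth nodup
      (fun c hc => (hchildren c).mp hc) sub'
    have hdesc : ∀ x ∈ ls.flatten, Desc parent x v := by
      intro x hx
      obtain ⟨c, hc, hd⟩ := (hmem x).mp hx
      exact ((hchildren c).mp hc).2 ▸ hd.to_parent
    have hnot : ∀ x ∈ ls.flatten, ¬ Desc parent v x := by
      intro x hx hd
      obtain ⟨c, hc, hd'⟩ := (hmem x).mp hx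
      obtain ⟨hcr, rfl⟩ := (hchildren c).mp hc
      have h1 := (hd.trans hd').depth_le hroot hdepth
      have h2 := hdepth c hcr
      omega
    refine ⟨fun x => ⟨fun hx => ?_, ?_⟩, ?_, fun c hc => ?_⟩
    · rcases List.mem_append.mp hx with hx | hx
      · exact hdesc x hx
      · rw [List.mem_singleton.mp hx]
        exact Desc.refl parent v
    · rintro ⟨k, hk⟩
      induction k with
      | zero => simp [show x = v from hk]
      | succ k ihk =>
        rw [Function.iterate_succ_apply'] at hk
        by_cases hr : parent^[k] x = root
        · rw [hr, hroot, ← hr] at hk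
          exact ihk hk
        · exact List.mem_append_left _
            ((hmem x).mpr ⟨_, (hchildren _).mpr ⟨hr, hk⟩, k, rfl⟩)
    · refine hnd.append (List.nodup_singleton v) fun x hx hx' => ?_
      rw [List.mem_singleton.mp hx'] at hx
      exact hnot v hx (Desc.refl parent v)
    · rcases List.mem_append.mp hc with hc | hc
      · obtain ⟨l₁, l₂, l₃, heq, h₁, h₂, h₃⟩ := hbl c hc
        refine ⟨l₁, l₂, l₃ ++ [v], by rw [heq]; simp, h₁, h₂, fun x hx hd => ?_⟩
        rcases List.mem_append.mp hx with hx | hx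
        · exact h₃ x hx hd
        · rw [List.mem_singleton.mp hx] at hd
          exact hnot c hc hd
      · rw [List.mem_singleton.mp hc]
        exact ⟨[], ls.flatten, [], by simp, by simp, hdesc, by simp⟩

/-- In what is left of a traversal, the states up to an ancestor `c` of the first one all lie in
the subtree of `c`. -/
lemma Blocks.of_suffix {l : List S} (hl : Blocks parent l) {g : S} {rest : List S}
    (hsuf : g :: rest <:+ l) {c : S} (hc : c ∈ l) (hg : Desc parent g c) :
    ∃ l₂ l₃ : List S, g :: rest = l₂ ++ c :: l₃ ∧ ∀ x ∈ l₂, Desc parent x c := by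
  obtain ⟨pre, hpre⟩ := hsuf
  obtain ⟨l₁, l₂, l₃, heq, h₁, h₂, h₃⟩ := hl c hc
  have key : ∃ a, l₂ ++ c :: l₃ = a ++ g :: rest := by
    rcases List.append_eq_append_iff.mp (hpre.trans heq) with ⟨b, hb, hb'⟩ | ⟨a, -, ha⟩
    · cases b with
      | nil => exact ⟨[], by simpa using hb'.symm⟩
      | cons y b =>
        rw [List.cons_append, List.cons.injEq] at hb'
        exact absurd hg (h₁ g (by rw [hb, ← hb'.1]; simp))
    · exact ⟨a, ha⟩
  obtain ⟨a, ha⟩ := key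
  rcases List.append_eq_append_iff.mp ha with ⟨b, -, hb⟩ | ⟨b, hb, hb'⟩
  · cases b with
    | nil => exact ⟨[], l₃, by simpa using hb.symm, by simp⟩
    | cons y b =>
      rw [List.cons_append, List.cons.injEq] at hb
      exact absurd hg (h₃ g (by rw [hb.2]; simp))
  · exact ⟨b, l₃, hb', fun x hx => h₂ x (by rw [hb]; simp [hx])⟩

lemma Blocks.head_desc {l : List S} (hl : Blocks parent l) (hnd : l.Nodup) {g g' : S}
    {rest rest' : List S} (hsuf : g :: rest <:+ l) (hsuf' : g' :: rest' <:+ g :: rest) {c : S}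
    (hc : c ∈ g' :: rest') (hg : Desc parent g c) : Desc parent g' c := by
  obtain ⟨l₂, l₃, heq, h₂⟩ := hl.of_suffix hsuf ((hsuf'.trans hsuf).subset hc) hg
  have hnd' : (l₂ ++ c :: l₃).Nodup := heq ▸ hnd.sublist hsuf.sublist
  obtain ⟨pre, hpre⟩ := hsuf'
  rcases List.append_eq_append_iff.mp (hpre.trans heq) with ⟨b, hpb, hb⟩ | ⟨b, -, hb'⟩
  · cases b with
    | nil =>
      rw [List.nil_append, List.cons.injEq] at hb
      exact hb.1 ▸ Desc.refl parent g'
    | cons y b =>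
      rw [List.cons_append, List.cons.injEq] at hb
      exact h₂ g' (by rw [hpb, hb.1]; simp)
  · cases b with
    | nil =>
      rw [List.nil_append, List.cons.injEq] at hb'
      exact hb'.1 ▸ Desc.refl parent c
    | cons y b =>
      rw [List.cons_append, List.cons.injEq] at hb'
      rw [List.nodup_append, List.nodup_cons] at hnd'
      exact absurd (by rw [hb'.2]; simp [hc]) hnd'.2.1.1

lemma exists_isPostOrder [Fintype S] {D : ℕ} (hdepth : ∀ v, v ≠ root → depth v = depth (parent v) + 1)
    (hD : ∀ v, depth v ≤ D) (v : S) : ∃ l, IsPostOrder parent root v l := by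
  classical
  induction hn : D - depth v using Nat.strong_induction_on generalizing v with
  | _ n ih =>
    have hchild : ∀ c : S, ∃ l, c ≠ root ∧ parent c = v → IsPostOrder parent root c l := by
      intro c
      by_cases hc : c ≠ root ∧ parent c = v
      · have h1 := hdepth c hc.1
        rw [hc.2] at h1
        have h2 := hD c
        obtain ⟨l, hl⟩ := ih (D - depth c) (by omega) c rfl
        exact ⟨l, fun _ => hl⟩
      · exact ⟨[], fun h => absurd h hc⟩
    choose f hf using hchild
    set children := (Finset.univ.filter fun c => c ≠ root ∧ parent c = v).toList with hdef
    have hmem : ∀ c, c ∈ children ↔ c ≠ root ∧ parent c = v := fun c => by simp [hdef]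
    refine ⟨_, .node v children (children.map f) (Finset.nodup_toList _) hmem ?_⟩
    rw [List.forall₂_map_right_iff, List.forall₂_same]
    exact fun c hc => hf c ((hmem c).mp hc)

end PostOrder

/-! ### The breadth-first tree -/

namespace NavTeach

variable {S : Type*} {A : Type*} {M : MDP S A} {L : QLearner S A}

/-- The depth of a state in the breadth-first tree, as a natural number (`0` for the unreachable
states, which do not occur when the diameter is finite). -/
noncomputable def depth (N : NavTeach M L) (v : S) : ℕ :=
  (M.dist N.root v).toNat

lemma depth_root (N : NavTeach M L) : N.depth N.root = 0 := by
  have : M.dist N.root N.root = 0 := by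
    refine le_antisymm (iInf₂_le_of_le 0 ⟨fun _ => N.root, rfl, rfl, ?_⟩ le_rfl) (zero_le)
    exact fun t ht => absurd ht (Nat.not_lt_zero t)
  rw [depth, this]
  rfl

lemma depth_parent {N : NavTeach M L} (hfin : ∀ v, M.dist N.root v ≠ ⊤) (v : S)
    (hv : v ≠ N.root) : N.depth v = N.depth (N.parent v) + 1 := by
  rw [depth, N.parent_dist v hv, ENat.toNat_add (hfin _) (by simp)]
  rfl

lemma order_spec {N : NavTeach M L} (hfin : ∀ v, M.dist N.root v ≠ ⊤) :
    (∀ x, x ∈ N.order) ∧ N.order.Nodup ∧ Blocks N.parent N.order := by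
  obtain ⟨h1, h2, h3⟩ := N.order_post.mem_nodup_blocks N.parent_root (depth_parent hfin)
  exact ⟨fun x => (h1 x).mpr (desc_root (depth_parent hfin) x), h2, h3⟩

lemma exists_next (N : NavTeach M L) {g s : S} (h : Desc N.parent g s) (hne : s ≠ g) :
    ∃ c, c ≠ N.root ∧ N.parent c = s ∧ Desc N.parent g c := by
  obtain ⟨k, hk⟩ := h
  induction k with
  | zero => exact absurd hk.symm hne
  | succ k ih =>
    rw [Function.iterate_succ_apply'] at hk
    by_cases hr : N.parent^[k] g = N.root
    · rw [hr, N.parent_root, ← hr] at hk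
      exact ih hk
    · exact ⟨_, hr, hk, k, rfl⟩

lemma depth_lt_of_next {N : NavTeach M L} (hfin : ∀ v, M.dist N.root v ≠ ⊤) {g c : S}
    (hc : c ≠ N.root) (hg : Desc N.parent g c) : N.depth (N.parent c) < N.depth g := by
  have h1 := hg.depth_le N.parent_root (depth_parent hfin)
  have h2 := depth_parent hfin c hc
  omega

/-! ### The potential -/

/-- The actions that can lead from the parent of `c` to `c`. -/
def navSet (N : NavTeach M L) (c : S) : Set A :=
  {a | 0 < M.P (N.parent c) a c}

lemma navSet_nonempty (N : NavTeach M L) {c : S} (hc : c ≠ N.root) : (N.navSet c).Nonempty :=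
  N.parent_edge c hc

/-- What an experience at the state `s` with the action `a` does to the Q-table while NavTeach
teaches the state `g`. -/
def Follows (N : NavTeach M L) (π : S → A) (g s : S) (a : A) (Q Q' : QTable S A) : Prop :=
  (∀ x b, (x, b) ≠ (s, a) → Q' x b = Q x b) ∧ Reranks (N.signal π g s a) (Q s) (Q' s) a

lemma Follows.row_eq {N : NavTeach M L} {π : S → A} {g s : S} {a : A} {Q Q' : QTable S A}
    (h : N.Follows π g s a Q Q') {x : S} (hx : x ≠ s) : Q' x = Q x :=
  funext fun b => h.1 x b fun e => hx (congrArg Prod.fst e)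

lemma Follows.rewards_goal {N : NavTeach M L} {π : S → A} {g : S} {a : A} {Q Q' : QTable S A}
    (h : N.Follows π g g a Q Q') : Rewards {π g} a (Q g) (Q' g) := by
  refine ⟨fun b hb => h.1 g b fun e => hb (congrArg Prod.snd e), ?_⟩
  have h2 := h.2
  rw [signal, if_pos rfl] at h2
  convert h2 using 2
  exact Set.mem_singleton_iff

lemma Follows.rewards_nav {N : NavTeach M L} (hfin : ∀ v, M.dist N.root v ≠ ⊤) {π : S → A}
    {g c : S} {a : A} {Q Q' : QTable S A} (hc : c ≠ N.root) (hg : Desc N.parent g c)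
    (h : N.Follows π g (N.parent c) a Q Q') :
    Rewards (N.navSet c) a (Q (N.parent c)) (Q' (N.parent c)) := by
  refine ⟨fun b hb => h.1 _ b fun e => hb (congrArg Prod.snd e), ?_⟩
  have h2 := h.2
  have hne : N.parent c ≠ g := fun e => by
    have := depth_lt_of_next hfin hc hg
    rw [e] at this
    omega
  have hiff : (∃ c', N.IsNext g (N.parent c) c' ∧ 0 < M.P (N.parent c) a c') ↔ a ∈ N.navSet c := by
    refine ⟨?_, fun ha => ⟨c, ⟨hc, rfl, hg⟩, ha⟩⟩
    rintro ⟨c', ⟨hc', hp, hg'⟩, ha⟩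
    have : c' = c := Desc.sibling_unique N.parent_root (depth_parent hfin) hg' hg hc' hc hp
    exact this ▸ ha
  rw [signal, if_neg hne, if_pos (show N.OnPath g (N.parent c) from hg.to_parent)] at h2
  convert h2 using 2
  exact hiff.symm

section Potential

variable [Fintype A]

open Classical in
/-- The work that concerns the state `c` while `g` is taught: to teach `c` itself, and to make its
parent navigate to `c`.  Both are counted as maximal as long as they have not begun; the second
begins with the first state in the subtree of `c`. -/
noncomputable def work (N : NavTeach M L) (π : S → A) (Q : QTable S A) (g c : S) : ℕ :=
  (if c = g then rowWork L.ε {π g} (Q g) else Fintype.card A) +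
  (if c = N.root then 0
    else if Desc N.parent g c then rowWork L.ε (N.navSet c) (Q (N.parent c)) else Fintype.card A)

open Classical in
/-- The total work that is left when the subtasks in the list are pending. -/
noncomputable def potential [Fintype S] (N : NavTeach M L) (π : S → A) (Q : QTable S A) :
    List S → ℕ
  | [] => 0
  | g :: rest => ∑ c, if c ∈ g :: rest then N.work π Q g c else 0

lemma work_le (N : NavTeach M L) (π : S → A) (Q : QTable S A) (g c : S) :
    N.work π Q g c ≤ 2 * Fintype.card A := by
  have h1 := rowWork_le L.ε {π g} (Q g)
  have h2 := rowWork_le L.ε (N.navSet c) (Q (N.parent c))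
  unfold work
  split_ifs <;> omega

lemma potential_le [Fintype S] (N : NavTeach M L) (π : S → A) (Q : QTable S A) (l : List S) :
    N.potential π Q l ≤ 2 * Fintype.card A * Fintype.card S := by
  cases l with
  | nil => exact Nat.zero_le _
  | cons g rest =>
    rw [potential, mul_comm, ← smul_eq_mul, ← Finset.card_univ]
    refine Finset.sum_le_card_nsmul _ _ _ fun c _ => ?_
    split_ifs
    · exact N.work_le π Q g c
    · exact Nat.zero_le _

lemma Follows.goal_le {N : NavTeach M L} {π : S → A} {g s : S} {a : A} {Q Q' : QTable S A}
    (h : N.Follows π g s a Q Q') :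
    rowWork L.ε {π g} (Q' g) ≤ rowWork L.ε {π g} (Q g) := by
  by_cases hs : g = s
  · subst hs
    exact h.rewards_goal.rowWork_le L.ε (Set.singleton_nonempty _)
  · rw [h.row_eq hs]

lemma Follows.nav_le {N : NavTeach M L} (hfin : ∀ v, M.dist N.root v ≠ ⊤) {π : S → A} {g s c : S}
    {a : A} {Q Q' : QTable S A} (h : N.Follows π g s a Q Q') (hc : c ≠ N.root)
    (hg : Desc N.parent g c) :
    rowWork L.ε (N.navSet c) (Q' (N.parent c)) ≤ rowWork L.ε (N.navSet c) (Q (N.parent c)) := by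
  by_cases hs : N.parent c = s
  · subst hs
    exact (h.rewards_nav hfin hc hg).rowWork_le L.ε (N.navSet_nonempty hc)
  · rw [h.row_eq hs]

lemma Follows.work_le {N : NavTeach M L} (hfin : ∀ v, M.dist N.root v ≠ ⊤) {π : S → A} {g s : S}
    {a : A} {Q Q' : QTable S A} (h : N.Follows π g s a Q Q') (c : S) :
    N.work π Q' g c ≤ N.work π Q g c := by
  unfold work
  split_ifs with h1 h2 h3 h3 h4
  · exact add_le_add h.goal_le le_rfl
  · exact add_le_add h.goal_le (h.nav_le hfin h2 h3)
  · exact add_le_add h.goal_le le_rfl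
  · exact le_rfl
  · exact add_le_add le_rfl (h.nav_le hfin h3 h4)
  · exact le_rfl

lemma Follows.potential_le [Fintype S] {N : NavTeach M L} (hfin : ∀ v, M.dist N.root v ≠ ⊤)
    {π : S → A} {g s : S} {a : A} {Q Q' : QTable S A} (h : N.Follows π g s a Q Q')
    (rest : List S) : N.potential π Q' (g :: rest) ≤ N.potential π Q (g :: rest) := by
  refine Finset.sum_le_sum fun c _ => ?_
  split_ifs
  · exact h.work_le hfin c
  · exact le_rfl

lemma Follows.potential_drop [Fintype S] {N : NavTeach M L} (hfin : ∀ v, M.dist N.root v ≠ ⊤)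
    {π : S → A} {g s c : S} {a : A} {Q Q' : QTable S A} (h : N.Follows π g s a Q Q')
    {rest : List S} (hc : c ∈ g :: rest) {δ : ℕ} (hδ : N.work π Q' g c + δ ≤ N.work π Q g c) :
    N.potential π Q' (g :: rest) + δ ≤ N.potential π Q (g :: rest) := by
  classical
  rw [potential, potential, ← Finset.add_sum_erase _ _ (Finset.mem_univ c),
    ← Finset.add_sum_erase _ _ (Finset.mem_univ c), if_pos hc, if_pos hc, add_right_comm]
  refine add_le_add hδ (Finset.sum_le_sum fun x _ => ?_)
  split_ifs
  · exact h.work_le hfin x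
  · exact le_rfl

/-- The potential does not grow when subtasks are completed.  This is where the post-order matters:
once the work of navigating to `c` has begun, the subtree of `c` is not left before `c` itself is
completed. -/
lemma potential_suffix [Fintype S] {N : NavTeach M L} (hfin : ∀ v, M.dist N.root v ≠ ⊤) (π : S → A)
    (Q : QTable S A) {l l' : List S} (hl : l <:+ N.order) (hl' : l' <:+ l) :
    N.potential π Q l' ≤ N.potential π Q l := by
  obtain ⟨-, hnd, hbl⟩ := order_spec hfin
  cases l' with
  | nil => exact Nat.zero_le _
  | cons g' rest' =>
    cases l with
    | nil => exact absurd (List.suffix_nil.mp hl') (List.cons_ne_nil _ _)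
    | cons g rest =>
      refine Finset.sum_le_sum fun c _ => ?_
      by_cases hc : c ∈ g' :: rest'
      · rw [if_pos hc, if_pos (hl'.subset hc), work, work]
        refine add_le_add ?_ ?_
        · by_cases h1 : c = g
          · subst h1
            have : g' = c := by
              by_contra hne
              rcases List.suffix_cons_iff.mp hl' with h | h
              · rw [List.cons.injEq] at h
                exact hne h.1
              · exact (List.nodup_cons.mp (hnd.sublist hl.sublist)).1 (h.subset hc)
            subst this
            exact le_rfl
          · rw [if_neg h1]
            split_ifs
            · exact rowWork_le _ _ _
            · exact le_rfl
        · split_ifs with h1 h2 h3 h3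
          · exact le_rfl
          · exact le_rfl
          · exact rowWork_le _ _ _
          · exact absurd (hbl.head_desc hnd hl hl' hc h3) h2
          · exact le_rfl
      · rw [if_neg hc]
        exact Nat.zero_le _

end Potential

/-! ### The subtasks along a history -/

variable {N : NavTeach M L} {Q₀ : QTable S A} {π : S → A}

lemma pending_suffix (h : Hist S A) : N.pending Q₀ π h <:+ N.order := by
  induction h with
  | nil => exact List.dropWhile_suffix _
  | cons e h ih => exact (List.dropWhile_suffix _).trans ih

lemma head_of_dropWhile {p : S → Bool} {l : List S} {g : S} {rest : List S}
    (h : l.dropWhile p = g :: rest) : p g = false := by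
  have := List.head?_dropWhile_not p l
  rw [h] at this
  simpa using this

lemma not_taughtAt_head {h : Hist S A} {g : S} {rest : List S}
    (hp : N.pending Q₀ π h = g :: rest) : ¬ TaughtAt (L.table Q₀ h) g (π g) := by
  cases h with
  | nil => simpa [QLearner.table] using head_of_dropWhile hp
  | cons e h => simpa using head_of_dropWhile hp

lemma of_notMem_dropWhile {p : S → Bool} {l : List S} {x : S} (hx : x ∈ l)
    (hx' : x ∉ l.dropWhile p) : p x = true := by
  rw [← List.takeWhile_append_dropWhile (p := p) (l := l), List.mem_append] at hx
  exact List.mem_takeWhile_imp (hx.resolve_right hx')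

/-- The history after one more experience, rewarded by NavTeach. -/
noncomputable abbrev extend (N : NavTeach M L) (Q₀ : QTable S A) (π : S → A) (h : Hist S A)
    (s : S) (a : A) (s' : S) : Hist S A :=
  (s, a, N.teacher Q₀ π h s a s', s') :: h

lemma follows_extend {h : Hist S A} {g : S} {rest : List S} (hp : N.pending Q₀ π h = g :: rest)
    (s : S) (a : A) (s' : S) :
    N.Follows π g s a (L.table Q₀ h) (L.table Q₀ (N.extend Q₀ π h s a s')) := by
  refine ⟨fun x b hxb => L.update_other _ _ _ _ _ _ _ hxb, ?_⟩
  rw [extend, QLearner.table, teacher, hp]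
  exact N.carrotStick_spec _ _ _ _ _

lemma pending_extend_suffix (h : Hist S A) (s : S) (a : A) (s' : S) :
    N.pending Q₀ π (N.extend Q₀ π h s a s') <:+ N.pending Q₀ π h :=
  List.dropWhile_suffix _

/-- The current subtask is not completed by an experience at another state. -/
lemma pending_extend_of_ne {h : Hist S A} {g : S} {rest : List S}
    (hp : N.pending Q₀ π h = g :: rest) {s : S} (hs : g ≠ s) (a : A) (s' : S) :
    N.pending Q₀ π (N.extend Q₀ π h s a s') = g :: rest := by
  have h1 : ¬ TaughtAt (L.table Q₀ (N.extend Q₀ π h s a s')) g (π g) := by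
    rw [TaughtAt, (follows_extend hp s a s').row_eq hs]
    exact not_taughtAt_head hp
  rw [extend, pending, hp, List.dropWhile_cons_of_neg]
  simpa using h1

/-- What holds throughout the teaching process: the states whose subtask is completed stay taught,
and rows without ties stay without ties. -/
def Inv [Fintype A] (N : NavTeach M L) (Q₀ : QTable S A) (π : S → A) (h : Hist S A) : Prop :=
  (∀ s, s ∉ N.pending Q₀ π h → TaughtAt (L.table Q₀ h) s (π s)) ∧
  ((L.ε : ℝ) ≤ 1 - 1 / (Fintype.card A : ℝ) ∨ ∀ s, Function.Injective (L.table Q₀ h s))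

lemma inv_nil [Fintype A] (hfin : ∀ v, M.dist N.root v ≠ ⊤)
    (htie : (L.ε : ℝ) ≤ 1 - 1 / (Fintype.card A : ℝ) ∨ ∀ s, Function.Injective (Q₀ s)) :
    N.Inv Q₀ π [] :=
  ⟨fun s hs => by simpa [QLearner.table] using of_notMem_dropWhile ((order_spec hfin).1 s) hs, htie⟩

lemma Inv.extend [Fintype A] (hfin : ∀ v, M.dist N.root v ≠ ⊤) {h : Hist S A}
    (hI : N.Inv Q₀ π h) {g : S} {rest : List S} (hp : N.pending Q₀ π h = g :: rest) (s : S) (a : A)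
    (s' : S) : N.Inv Q₀ π (N.extend Q₀ π h s a s') := by
  obtain ⟨hmem, hnd, hbl⟩ := order_spec hfin
  have hf := follows_extend hp s a s'
  refine ⟨fun x hx => ?_, hI.2.imp_right fun hinj x => ?_⟩
  · by_cases hxp : x ∈ N.pending Q₀ π h
    · simpa using of_notMem_dropWhile hxp hx
    · have ht := hI.1 x hxp
      by_cases hxs : x = s
      · subst hxs
        have hpath : ¬ N.OnPath g x := fun hd => by
          obtain ⟨l₂, l₃, heq, -⟩ := hbl.of_suffix (hp ▸ pending_suffix h) (hmem x) hd
          exact hxp (by rw [hp, heq]; simp)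
        have hne : x ≠ g := fun e => hpath ⟨0, e.symm⟩
        have h2 := hf.2
        rw [signal, if_neg hne, if_neg hpath] at h2
        exact isMax_of_maintain (fun b hb => hf.1 x b fun e => hb (congrArg Prod.snd e)) h2 ht
      · rw [TaughtAt, hf.row_eq hxs]
        exact ht
  · by_cases hxs : x = s
    · subst hxs
      exact injective_of_reranks (hinj x)
        (fun b hb => hf.1 x b fun e => hb (congrArg Prod.snd e)) hf.2
    · rw [hf.row_eq hxs]
      exact hinj x

lemma potential_pending_extend_le [Fintype A] [Fintype S] (hfin : ∀ v, M.dist N.root v ≠ ⊤) (h : Hist S A)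
    (s : S) (a : A) (s' : S) :
    N.potential π (L.table Q₀ (N.extend Q₀ π h s a s')) (N.pending Q₀ π (N.extend Q₀ π h s a s'))
      ≤ N.potential π (L.table Q₀ (N.extend Q₀ π h s a s')) (N.pending Q₀ π h) :=
  potential_suffix hfin π _ (pending_suffix h) (pending_extend_suffix h s a s')

/-- At the state that is being taught, and on the way to it at a state that is not yet greedy for
navigating, the potential drops in expectation by `1 / 2`. -/
lemma exists_potential_drop [Fintype A] [Fintype S] (hfin : ∀ v, M.dist N.root v ≠ ⊤)
    {h : Hist S A} (hI : N.Inv Q₀ π h) {g : S} {rest : List S}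
    (hp : N.pending Q₀ π h = g :: rest) {s : S}
    (hs : s = g ∨ ∃ c, c ≠ N.root ∧ N.parent c = s ∧ Desc N.parent g c ∧
      L.greedy (L.table Q₀ h) s ∉ N.navSet c) :
    ∃ (a : A) (δ : ℕ), 1 / 2 ≤ (L.policy (L.table Q₀ h) s a).toReal * δ ∧ ∀ s',
      N.potential π (L.table Q₀ (N.extend Q₀ π h s a s'))
        (N.pending Q₀ π (N.extend Q₀ π h s a s')) + δ
        ≤ N.potential π (L.table Q₀ h) (N.pending Q₀ π h) := by
  obtain ⟨hmem, hnd, hbl⟩ := order_spec hfin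
  rcases hs with rfl | ⟨c, hc, rfl, hg, hgr⟩
  · have hnt := not_taughtAt_head hp
    have htie : (L.ε : ℝ) ≤ 1 - 1 / (Fintype.card A : ℝ) ∨
        L.greedy (L.table Q₀ h) s ∉ ({π s} : Set A) := by
      refine hI.2.imp_right fun hinj hgr => hnt fun b hb => ?_
      rw [Set.mem_singleton_iff] at hgr
      have := L.greedy_max (L.table Q₀ h) s b
      rw [hgr] at this
      exact lt_of_le_of_ne this ((hinj s).ne hb)
    obtain ⟨a, δ, h1, h2⟩ := exists_rowWork_drop L.ε_le_one (Set.singleton_nonempty (π s))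
      (L.greedy_max (L.table Q₀ h) s) (obstacles_singleton_nonempty hnt) htie
    refine ⟨a, δ, h1, fun s' => ?_⟩
    have hf := follows_extend hp s a s'
    refine le_trans (Nat.add_le_add_right (potential_pending_extend_le hfin h s a s') δ) ?_
    rw [hp]
    refine hf.potential_drop hfin List.mem_cons_self (c := s) ?_
    have h3 := h2 _ hf.rewards_goal
    rw [work, work, if_pos rfl, if_pos rfl]
    split_ifs with h4 h5
    · exact h3
    · have := hf.nav_le hfin h4 h5
      omega
    · omega
  · have hobs : (obstacles (N.navSet c) (L.table Q₀ h (N.parent c))).Nonempty :=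
      ⟨_, mem_obstacles.mpr ⟨hgr, fun a _ => L.greedy_max _ _ a⟩⟩
    obtain ⟨a, δ, h1, h2⟩ := exists_rowWork_drop L.ε_le_one (N.navSet_nonempty hc)
      (L.greedy_max (L.table Q₀ h) (N.parent c)) hobs (.inr hgr)
    refine ⟨a, δ, h1, fun s' => ?_⟩
    have hf := follows_extend hp (N.parent c) a s'
    refine le_trans (Nat.add_le_add_right (potential_pending_extend_le hfin h _ a s') δ) ?_
    have hcp : c ∈ g :: rest := by
      obtain ⟨l₂, l₃, heq, -⟩ := hbl.of_suffix (hp ▸ pending_suffix h) (hmem c) hg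
      rw [heq]
      simp
    rw [hp]
    refine hf.potential_drop hfin hcp ?_
    have h3 := h2 _ (hf.rewards_nav hfin hc hg)
    rw [work, work, if_neg hc, if_neg hc, if_pos hg, if_pos hg, add_assoc]
    refine add_le_add ?_ h3
    split_ifs
    · exact hf.goal_le
    · exact le_rfl

end NavTeach

/-! ### The drift -/

namespace NavTeach

variable {S : Type*} {A : Type*} {M : MDP S A} {L : QLearner S A}

open Classical in
/-- A lower bound for the drop of the potential that the rest of the current episode will bring in
expectation, `t` steps after its beginning and at the state `s`.  It is positive only if `s` lies on
the tree path to the state that is being taught, at depth `t`: then no step of the episode has been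
lost, and the state that is being taught can still be reached before the reset. -/
noncomputable def chance (N : NavTeach M L) (q : ℝ) (D t : ℕ) (s : S) : List S → ℝ
  | [] => 0
  | g :: _ => if N.depth s = t ∧ Desc N.parent g s then q ^ (D - t) / 2 else 0

lemma chance_nonneg (N : NavTeach M L) {q : ℝ} (hq : 0 ≤ q) (D t : ℕ) (s : S) (l : List S) :
    0 ≤ N.chance q D t s l := by
  cases l with
  | nil => exact le_rfl
  | cons g rest =>
    rw [chance]
    split_ifs <;> positivity

lemma chance_le_half (N : NavTeach M L) {q : ℝ} (hq : 0 ≤ q) (hq1 : q ≤ 1) (D t : ℕ) (s : S)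
    (l : List S) : N.chance q D t s l ≤ 1 / 2 := by
  cases l with
  | nil => norm_num [chance]
  | cons g rest =>
    rw [chance]
    have := pow_le_one₀ (n := D - t) hq hq1
    split_ifs <;> linarith

lemma chance_root {N : NavTeach M L} (hfin : ∀ v, M.dist N.root v ≠ ⊤) (q : ℝ) (D : ℕ) (g : S) (rest : List S) :
    N.chance q D 0 N.root (g :: rest) = q ^ D / 2 := by
  rw [chance, if_pos ⟨N.depth_root, desc_root (depth_parent hfin) g⟩, Nat.sub_zero]

/-- The state in which the step after the one that leads to `s'` begins. -/
noncomputable def restart (N : NavTeach M L) (h : Hist S A) (s' : S) : S :=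
  if (h.length + 1) % M.H = 0 then N.root else s'

lemma tsum_teachStep_mul [Fintype A] {N : NavTeach M L} {Q₀ : QTable S A} {π : S → A}
    {h : Hist S A} (hμ : M.μ₀ = PMF.pure N.root)
    (hnt : ¬ Taught (L.table Q₀ h) π) (s : S) (V : Hist S A × S → ℝ≥0∞) :
    ∑' c, teachStep M L Q₀ π (N.teacher Q₀ π) (h, s) c * V c =
      ∑' a, L.policy (L.table Q₀ h) s a *
        ∑' s', M.P s a s' * V (N.extend Q₀ π h s a s', N.restart h s') := by
  rw [teachStep, if_neg hnt, PMF.tsum_bind_mul]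
  refine tsum_congr fun a => ?_
  rw [PMF.tsum_bind_mul]
  congr 1
  refine tsum_congr fun s' => ?_
  unfold restart
  split_ifs
  · rw [hμ, PMF.pure_map, PMF.tsum_pure_mul]
  · rw [PMF.tsum_pure_mul]

variable [Fintype S] [Fintype A]

lemma one_le_potential {N : NavTeach M L} {Q₀ : QTable S A} {π : S → A} {h : Hist S A} {g : S}
    {rest : List S} (hp : N.pending Q₀ π h = g :: rest) :
    1 ≤ N.potential π (L.table Q₀ h) (N.pending Q₀ π h) := by
  classical
  have hobs := obstacles_singleton_nonempty (not_taughtAt_head hp)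
  rw [hp]
  calc 1 ≤ rowWork L.ε {π g} (L.table Q₀ h g) := by
        unfold rowWork
        split_ifs with h1 h2
        · exact Finset.card_pos.mpr hobs
        · exact absurd h2 hobs.ne_empty
        · exact Fintype.card_pos_iff.mpr ⟨π g⟩
    _ ≤ N.work π (L.table Q₀ h) g g := by
        rw [work, if_pos rfl]
        exact Nat.le_add_right _ _
    _ = if g ∈ g :: rest then N.work π (L.table Q₀ h) g g else 0 := by simp
    _ ≤ _ := Finset.single_le_sum (f := fun c => if c ∈ g :: rest then
        N.work π (L.table Q₀ h) g c else 0) (fun _ _ => Nat.zero_le _) (Finset.mem_univ g)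

/-- A bound for the expected number of steps that remain: every unit of the potential costs
`2 / q ^ D` episodes. -/
noncomputable def lyapunov (N : NavTeach M L) (Q₀ : QTable S A) (π : S → A) (q : ℝ) (D : ℕ)
    (h : Hist S A) (s : S) : ℝ :=
  match N.pending Q₀ π h with
  | [] => 0
  | g :: rest => 2 * M.H / q ^ D * (N.potential π (L.table Q₀ h) (g :: rest)
      - N.chance q D (h.length % M.H) s (g :: rest)) + (M.H - (h.length % M.H : ℕ))

/-- The drop of the potential in one step, together with the chance of the next state unless the
episode ends. -/
noncomputable def gain (N : NavTeach M L) (Q₀ : QTable S A) (π : S → A) (q : ℝ) (D : ℕ)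
    (h : Hist S A) (s : S) (a : A) (s' : S) : ℝ :=
  N.potential π (L.table Q₀ h) (N.pending Q₀ π h)
    - N.potential π (L.table Q₀ (N.extend Q₀ π h s a s')) (N.pending Q₀ π (N.extend Q₀ π h s a s'))
    + if (h.length + 1) % M.H = 0 then 0
      else N.chance q D (h.length % M.H + 1) s' (N.pending Q₀ π (N.extend Q₀ π h s a s'))

variable {N : NavTeach M L} {Q₀ : QTable S A} {π : S → A} {q : ℝ} {D : ℕ} {h : Hist S A} {g : S}
  {rest : List S}

lemma lyapunov_eq (hp : N.pending Q₀ π h = g :: rest) (s : S) :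
    N.lyapunov Q₀ π q D h s = 2 * M.H / q ^ D * (N.potential π (L.table Q₀ h) (N.pending Q₀ π h)
      - N.chance q D (h.length % M.H) s (N.pending Q₀ π h)) + (M.H - (h.length % M.H : ℕ)) := by
  rw [lyapunov]
  split
  · next h0 => rw [hp] at h0; exact absurd h0 (List.cons_ne_nil _ _)
  · next h0 => rw [h0]

lemma lyapunov_eq_zero (hp : N.pending Q₀ π h = []) (s : S) : N.lyapunov Q₀ π q D h s = 0 := by
  rw [lyapunov]
  split
  · rfl
  · next h0 => rw [hp] at h0; exact absurd h0.symm (List.cons_ne_nil _ _)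

lemma one_le_lyapunov (hH : D < M.H) (hq : 0 ≤ q) (hq1 : q ≤ 1)
    (hp : N.pending Q₀ π h = g :: rest) (s : S) : 1 ≤ N.lyapunov Q₀ π q D h s := by
  rw [lyapunov_eq hp]
  have h1 : (1 : ℝ) ≤ N.potential π (L.table Q₀ h) (N.pending Q₀ π h) := by
    exact_mod_cast one_le_potential hp
  have h2 := N.chance_le_half hq hq1 D (h.length % M.H) s (N.pending Q₀ π h)
  have h3 : ((h.length % M.H : ℕ) : ℝ) + 1 ≤ M.H := by
    exact_mod_cast Nat.mod_lt h.length (show 0 < M.H by omega)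
  have h4 : 0 ≤ 2 * M.H / q ^ D * (N.potential π (L.table Q₀ h) (N.pending Q₀ π h)
      - N.chance q D (h.length % M.H) s (N.pending Q₀ π h)) :=
    mul_nonneg (by positivity) (by linarith)
  linarith

lemma lyapunov_nonneg (hH : D < M.H) (hq : 0 ≤ q) (hq1 : q ≤ 1) (h : Hist S A) (s : S) :
    0 ≤ N.lyapunov Q₀ π q D h s := by
  cases hp : N.pending Q₀ π h with
  | nil => rw [lyapunov_eq_zero hp]
  | cons g rest => exact zero_le_one.trans (one_le_lyapunov hH hq hq1 hp s)

lemma potential_extend_le (hfin : ∀ v, M.dist N.root v ≠ ⊤)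
    (hp : N.pending Q₀ π h = g :: rest) (s : S) (a : A) (s' : S) :
    N.potential π (L.table Q₀ (N.extend Q₀ π h s a s')) (N.pending Q₀ π (N.extend Q₀ π h s a s'))
      ≤ N.potential π (L.table Q₀ h) (N.pending Q₀ π h) := by
  refine (potential_pending_extend_le hfin h s a s').trans ?_
  rw [hp]
  exact (follows_extend hp s a s').potential_le hfin rest

lemma gain_ge (hq : 0 ≤ q) (s : S) (a : A) (s' : S) :
    (N.potential π (L.table Q₀ h) (N.pending Q₀ π h) : ℝ)
    - N.potential π (L.table Q₀ (N.extend Q₀ π h s a s')) (N.pending Q₀ π (N.extend Q₀ π h s a s'))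
      ≤ N.gain Q₀ π q D h s a s' := by
  rw [gain]
  have := N.chance_nonneg hq D (h.length % M.H + 1) s' (N.pending Q₀ π (N.extend Q₀ π h s a s'))
  split_ifs <;> linarith

lemma gain_nonneg (hfin : ∀ v, M.dist N.root v ≠ ⊤) (hq : 0 ≤ q)
    (hp : N.pending Q₀ π h = g :: rest) (s : S) (a : A) (s' : S) :
    0 ≤ N.gain Q₀ π q D h s a s' := by
  have h1 : (N.potential π (L.table Q₀ (N.extend Q₀ π h s a s'))
      (N.pending Q₀ π (N.extend Q₀ π h s a s')) : ℝ)
      ≤ N.potential π (L.table Q₀ h) (N.pending Q₀ π h) := by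
    exact_mod_cast potential_extend_le hfin hp s a s'
  have := gain_ge (N := N) (Q₀ := Q₀) (π := π) (D := D) (h := h) hq s a s'
  linarith

lemma lyapunov_extend_le (hfin : ∀ v, M.dist N.root v ≠ ⊤) (hH : D < M.H)
    (hqD : 0 < q ^ D) (s : S) (a : A) (s' : S) :
    N.lyapunov Q₀ π q D (N.extend Q₀ π h s a s') (N.restart h s') ≤
      2 * M.H / q ^ D * (N.potential π (L.table Q₀ h) (N.pending Q₀ π h)
        - N.gain Q₀ π q D h s a s') + (M.H - (h.length % M.H : ℕ)) - 1 := by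
  have hHpos : 0 < M.H := by omega
  have hK : 0 ≤ 2 * (M.H : ℝ) / q ^ D := by positivity
  have hτ := Nat.mod_lt h.length hHpos
  have hτR : ((h.length % M.H : ℕ) : ℝ) + 1 ≤ M.H := by exact_mod_cast hτ
  have hlen : (N.extend Q₀ π h s a s').length = h.length + 1 := rfl
  cases hp' : N.pending Q₀ π (N.extend Q₀ π h s a s') with
  | nil =>
    rw [lyapunov_eq_zero hp', gain, hp']
    simp only [potential, chance, ite_self]
    norm_num
    linarith
  | cons g' rest' =>
    rw [lyapunov_eq hp', hlen, gain, restart]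
    by_cases hr : (h.length + 1) % M.H = 0
    · -- The chance `q ^ D / 2` at the root pays for the `H` steps of the new episode.
      rw [if_pos hr, if_pos hr, hr, hp', chance_root hfin _ _]
      have : 2 * (M.H : ℝ) / q ^ D * (q ^ D / 2) = M.H := by field_simp
      rw [mul_sub, this]
      push_cast
      nlinarith
    · have hmod : (h.length + 1) % M.H = h.length % M.H + 1 := by
        rw [Nat.add_mod] at hr ⊢
        rcases Nat.lt_or_ge 1 M.H with h1 | h1
        · rw [Nat.mod_eq_of_lt h1] at hr ⊢
          refine Nat.mod_eq_of_lt (lt_of_le_of_ne hτ fun e => hr ?_)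
          rw [e, Nat.mod_self]
        · have : M.H = 1 := by omega
          exact absurd (by rw [this]; exact Nat.mod_one _) hr
      rw [if_neg hr, if_neg hr, hmod, hp']
      push_cast
      linarith

/-- The expected gain of a step is at least the chance at its beginning. -/
lemma chance_le_sum_gain (hfin : ∀ v, M.dist N.root v ≠ ⊤) (hH : D < M.H)
    (hD : ∀ v, N.depth v ≤ D) (hq : 0 ≤ q) (hq1 : q ≤ 1)
    (hqP : ∀ s a s', 0 < M.P s a s' → q ≤ (1 - L.ε) * (M.P s a s').toReal)
    (hI : N.Inv Q₀ π h) (hp : N.pending Q₀ π h = g :: rest) (s : S) :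
    N.chance q D (h.length % M.H) s (N.pending Q₀ π h) ≤
      ∑ a, (L.policy (L.table Q₀ h) s a).toReal *
        ∑ s', (M.P s a s').toReal * N.gain Q₀ π q D h s a s' := by
  have hin : ∀ a s', 0 ≤ (M.P s a s').toReal * N.gain Q₀ π q D h s a s' := fun a s' =>
    mul_nonneg ENNReal.toReal_nonneg (gain_nonneg hfin hq hp s a s')
  have hout : ∀ a, 0 ≤ (L.policy (L.table Q₀ h) s a).toReal *
      ∑ s', (M.P s a s').toReal * N.gain Q₀ π q D h s a s' := fun a =>
    mul_nonneg ENNReal.toReal_nonneg (Finset.sum_nonneg fun s' _ => hin a s')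
  have hone : ∀ a, _ ≤ _ := fun a => Finset.single_le_sum (fun a _ => hout a) (Finset.mem_univ a)
  by_cases hon : N.depth s = h.length % M.H ∧ Desc N.parent g s
  swap
  · rw [hp, chance, if_neg hon]
    exact Finset.sum_nonneg fun a _ => hout a
  by_cases hs : s = g ∨ ∃ c, c ≠ N.root ∧ N.parent c = s ∧ Desc N.parent g c ∧
      L.greedy (L.table Q₀ h) s ∉ N.navSet c
  · obtain ⟨a, δ, h1, h2⟩ := exists_potential_drop hfin hI hp hs
    refine (N.chance_le_half hq hq1 _ _ _ _).trans (h1.trans (le_trans ?_ (hone a)))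
    refine mul_le_mul_of_nonneg_left ?_ ENNReal.toReal_nonneg
    calc (δ : ℝ) = ∑ s', (M.P s a s').toReal * δ := by
          rw [← Finset.sum_mul, PMF.sum_toReal, one_mul]
      _ ≤ _ := by
          refine Finset.sum_le_sum fun s' _ => mul_le_mul_of_nonneg_left ?_ ENNReal.toReal_nonneg
          refine le_trans ?_ (gain_ge hq s a s')
          have : (N.potential π (L.table Q₀ (N.extend Q₀ π h s a s'))
            (N.pending Q₀ π (N.extend Q₀ π h s a s')) : ℝ) + δ
            ≤ N.potential π (L.table Q₀ h) (N.pending Q₀ π h) := by exact_mod_cast h2 s'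
          linarith
  · push Not at hs
    obtain ⟨c, hc, hcs, hg⟩ := N.exists_next hon.2 hs.1
    have ha := hs.2 c hc hcs hg
    set a := L.greedy (L.table Q₀ h) s with hadef
    have hP : 0 < M.P s a c := hcs ▸ ha
    have hlt := depth_lt_of_next hfin hc hg
    have hdc := depth_parent hfin c hc
    rw [hcs, hon.1] at hlt hdc
    have hDg := hD g
    have hmod : (h.length + 1) % M.H = h.length % M.H + 1 := by
      rw [Nat.add_mod, Nat.mod_eq_of_lt (show 1 < M.H by omega)]
      exact Nat.mod_eq_of_lt (by omega)
    have hgain : q ^ (D - (h.length % M.H + 1)) / 2 ≤ N.gain Q₀ π q D h s a c := by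
      have h1 : (N.potential π (L.table Q₀ (N.extend Q₀ π h s a c))
          (N.pending Q₀ π (N.extend Q₀ π h s a c)) : ℝ)
          ≤ N.potential π (L.table Q₀ h) (N.pending Q₀ π h) := by
        exact_mod_cast potential_extend_le hfin hp s a c
      rw [gain, if_neg (by omega)]
      rw [pending_extend_of_ne hp hs.1.symm] at h1 ⊢
      rw [chance, if_pos ⟨hdc, hg⟩]
      linarith
    have hw : 1 - (L.ε : ℝ) ≤ (L.policy (L.table Q₀ h) s a).toReal := by
      have h1 := one_sub_le_epsGreedyWeight L.ε a
      have h2 := ENNReal.toReal_mono ((L.policy (L.table Q₀ h) s).apply_ne_top a) h1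
      rwa [ENNReal.toReal_sub_of_le (by exact_mod_cast L.ε_le_one) ENNReal.one_ne_top] at h2
    rw [hp, chance, if_pos hon]
    refine le_trans ?_ ((mul_le_mul_of_nonneg_left (Finset.single_le_sum
      (fun s' _ => hin a s') (Finset.mem_univ c)) ENNReal.toReal_nonneg).trans (hone a))
    calc q ^ (D - h.length % M.H) / 2 = q * (q ^ (D - (h.length % M.H + 1)) / 2) := by
          rw [show D - h.length % M.H = (D - (h.length % M.H + 1)) + 1 by omega, pow_succ]
          ring
      _ ≤ ((1 - L.ε) * (M.P s a c).toReal) * N.gain Q₀ π q D h s a c :=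
          mul_le_mul (hqP s a c hP) hgain (by positivity) (hq.trans (hqP s a c hP))
      _ ≤ ((L.policy (L.table Q₀ h) s a).toReal * (M.P s a c).toReal) *
            N.gain Q₀ π q D h s a c := by
          refine mul_le_mul_of_nonneg_right ?_ (gain_nonneg hfin hq hp s a c)
          exact mul_le_mul_of_nonneg_right hw ENNReal.toReal_nonneg
      _ = _ := mul_assoc _ _ _

lemma drift (hfin : ∀ v, M.dist N.root v ≠ ⊤) (hH : D < M.H) (hμ : M.μ₀ = PMF.pure N.root)
    (hD : ∀ v, N.depth v ≤ D) (hq : 0 ≤ q) (hq1 : q ≤ 1) (hqD : 0 < q ^ D)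
    (hqP : ∀ s a s', 0 < M.P s a s' → q ≤ (1 - L.ε) * (M.P s a s').toReal)
    (hI : N.Inv Q₀ π h) (hp : N.pending Q₀ π h = g :: rest) (s : S) {V : Hist S A × S → ℝ≥0∞}
    (hV : ∀ h s, N.Inv Q₀ π h → V (h, s) = ENNReal.ofReal (N.lyapunov Q₀ π q D h s)) :
    1 + ∑' c, teachStep M L Q₀ π (N.teacher Q₀ π) (h, s) c * V c ≤ V (h, s) := by
  have hnt : ¬ Taught (L.table Q₀ h) π := fun ht => not_taughtAt_head hp (ht g)
  set Ψ : ℝ := ((N.potential π (L.table Q₀ h) (N.pending Q₀ π h) : ℕ) : ℝ)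
  set K : ℝ := 2 * M.H / q ^ D with hK
  have hK0 : 0 ≤ K := by positivity
  set w : A → ℝ := fun a => (L.policy (L.table Q₀ h) s a).toReal with hw
  set B : A → S → ℝ := fun a s' => N.lyapunov Q₀ π q D (N.extend Q₀ π h s a s') (N.restart h s')
    with hB
  have hB0 : ∀ a s', 0 ≤ B a s' := fun a s' => lyapunov_nonneg hH hq hq1 _ _
  have hsum : ∑ a, w a * ∑ s', (M.P s a s').toReal * B a s' ≤ N.lyapunov Q₀ π q D h s - 1 := by
    set E : ℝ := K * Ψ + (M.H - (h.length % M.H : ℕ)) - 1 with hE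
    calc ∑ a, w a * ∑ s', (M.P s a s').toReal * B a s'
        ≤ ∑ a, w a * ∑ s', (M.P s a s').toReal * (E - K * N.gain Q₀ π q D h s a s') := by
          refine Finset.sum_le_sum fun a _ => mul_le_mul_of_nonneg_left
            (Finset.sum_le_sum fun s' _ => mul_le_mul_of_nonneg_left ?_ ENNReal.toReal_nonneg)
            ENNReal.toReal_nonneg
          refine (lyapunov_extend_le hfin hH hqD s a s').trans (le_of_eq ?_)
          ring
      _ = E - K * ∑ a, w a * ∑ s', (M.P s a s').toReal * N.gain Q₀ π q D h s a s' := by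
          have h1 : ∀ a, ∑ s', (M.P s a s').toReal * (E - K * N.gain Q₀ π q D h s a s') =
              E - K * ∑ s', (M.P s a s').toReal * N.gain Q₀ π q D h s a s' := by
            intro a
            simp_rw [mul_sub, Finset.sum_sub_distrib, ← Finset.sum_mul, PMF.sum_toReal, one_mul,
              Finset.mul_sum, mul_left_comm K]
          simp_rw [h1, mul_sub, Finset.sum_sub_distrib, ← Finset.sum_mul, hw, PMF.sum_toReal,
            one_mul, mul_left_comm _ K, ← Finset.mul_sum]
      _ ≤ E - K * N.chance q D (h.length % M.H) s (N.pending Q₀ π h) := by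
          have := mul_le_mul_of_nonneg_left
            (chance_le_sum_gain hfin hH hD hq hq1 hqP hI hp s) hK0
          linarith
      _ = _ := by
          rw [lyapunov_eq hp]
          ring
  rw [tsum_teachStep_mul hμ hnt, hV h s hI]
  simp_rw [hV _ _ (hI.extend hfin hp _ _ _)]
  have h1 : ∀ a, ∑' s', M.P s a s' * ENNReal.ofReal (B a s') =
      ENNReal.ofReal (∑ s', (M.P s a s').toReal * B a s') := fun a =>
    PMF.tsum_mul_ofReal _ _ (hB0 a)
  simp_rw [hB] at h1
  simp_rw [h1]
  rw [PMF.tsum_mul_ofReal _ _ fun a => Finset.sum_nonneg fun s' _ =>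
    mul_nonneg ENNReal.toReal_nonneg (hB0 a s')]
  have hge := one_le_lyapunov (N := N) (Q₀ := Q₀) (π := π) hH hq hq1 hp s
  calc _ ≤ ENNReal.ofReal 1 + ENNReal.ofReal (N.lyapunov Q₀ π q D h s - 1) := by
        rw [ENNReal.ofReal_one]
        gcongr
    _ = _ := by
        rw [← ENNReal.ofReal_add zero_le_one (by linarith)]
        congr 1
        ring

/-- The bound on the expected number of steps, for a common lower bound `q` for the probabilities of
following one edge of the tree at a state whose greedy action navigates. -/
lemma expectedSteps_le (hfin : ∀ v, M.dist N.root v ≠ ⊤) (hH : D < M.H)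
    (hμ : M.μ₀ = PMF.pure N.root) (hD : ∀ v, N.depth v ≤ D) (hq : 0 ≤ q) (hq1 : q ≤ 1)
    (hqD : 0 < q ^ D)
    (hqP : ∀ s a s', 0 < M.P s a s' → q ≤ (1 - L.ε) * (M.P s a s').toReal)
    (htie : (L.ε : ℝ) ≤ 1 - 1 / (Fintype.card A : ℝ) ∨ ∀ s, Function.Injective (Q₀ s)) :
    expectedSteps M L Q₀ π (N.teacher Q₀ π) ≤
      ENNReal.ofReal (4 * Fintype.card S * Fintype.card A * M.H * (q ^ D)⁻¹) := by
  classical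
  -- Histories that violate the invariant are never reached, so `V` may be infinite there.
  set V : Hist S A × S → ℝ≥0∞ := fun c =>
    if N.Inv Q₀ π c.1 then ENNReal.ofReal (N.lyapunov Q₀ π q D c.1 c.2) else ⊤ with hVdef
  have hV : ∀ h s, N.Inv Q₀ π h → V (h, s) = ENNReal.ofReal (N.lyapunov Q₀ π q D h s) :=
    fun h s hI => if_pos hI
  refine (tsum_toOuterMeasure_le_of_drift _ (teachStep M L Q₀ π (N.teacher Q₀ π))
    (fun n => rfl) {c | ¬ Taught (L.table Q₀ c.1) π} V ?_ ?_).trans ?_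
  · rintro ⟨h, s⟩ hnt
    by_cases hI : N.Inv Q₀ π h
    · cases hp : N.pending Q₀ π h with
      | nil => exact absurd (fun x => hI.1 x (by rw [hp]; exact List.not_mem_nil)) hnt
      | cons g rest => exact drift hfin hH hμ hD hq hq1 hqD hqP hI hp s hV
    · simp only [hVdef, if_neg hI]
      exact le_top
  · rintro ⟨h, s⟩ ht
    rw [Set.mem_ofPred_eq, not_not] at ht
    rw [teachStep, if_pos ht, PMF.tsum_pure_mul]
  · rw [teachLaw, hμ, PMF.pure_map, PMF.tsum_pure_mul, hV _ _ (inv_nil hfin htie)]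
    refine ENNReal.ofReal_le_ofReal ?_
    cases hp : N.pending Q₀ π [] with
    | nil =>
      rw [lyapunov_eq_zero hp]
      positivity
    | cons g rest =>
      rw [lyapunov_eq hp, List.length_nil, Nat.zero_mod, hp, chance_root hfin _ _]
      have h1 : (N.potential π (L.table Q₀ []) (g :: rest) : ℝ)
          ≤ 2 * Fintype.card A * Fintype.card S := by
        exact_mod_cast N.potential_le π (L.table Q₀ []) (g :: rest)
      have h2 : 2 * (M.H : ℝ) / q ^ D * (q ^ D / 2) = M.H := by field_simp
      rw [mul_sub, h2]
      calc _ = 2 * (M.H : ℝ) / q ^ D * N.potential π (L.table Q₀ []) (g :: rest) := by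
            push_cast
            ring
        _ ≤ 2 * (M.H : ℝ) / q ^ D * (2 * Fintype.card A * Fintype.card S) := by gcongr
        _ = _ := by
            rw [div_eq_mul_inv]
            ring

end NavTeach

/-! ### The diameter and the existence of NavTeach -/

section Existence

variable {S : Type*} {A : Type*} {M : MDP S A}

lemma dist_le_of_diameter {D : ℕ} (hM : M.diameter = (D : ℕ∞)) {s₀ : S}
    (hμ : M.μ₀ = PMF.pure s₀) (s : S) : M.dist s₀ s ≤ D := by
  classical
  have h1 : ⨅ (s₀' : S) (_ : 0 < M.μ₀ s₀'), M.dist s₀' s ≤ D :=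
    hM ▸ le_iSup (fun s => ⨅ (s₀' : S) (_ : 0 < M.μ₀ s₀'), M.dist s₀' s) s
  refine le_trans (le_iInf₂ fun s₀' h => ?_) h1
  rw [hμ, PMF.pure_apply] at h
  by_cases he : s₀' = s₀
  · rw [he]
  · simp [he] at h

lemma NavTeach.root_eq {L : QLearner S A} (N : NavTeach M L) {s₀ : S} (hμ : M.μ₀ = PMF.pure s₀) :
    N.root = s₀ := by
  classical
  have h := N.root_mem
  rw [hμ, PMF.pure_apply] at h
  by_contra he
  simp [he] at h

lemma exists_bfs_parent {s₀ : S} (hfin : ∀ v, M.dist s₀ v ≠ ⊤) (v : S) (hv : v ≠ s₀) :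
    ∃ u, M.Edge u v ∧ M.dist s₀ v = M.dist s₀ u + 1 := by
  obtain ⟨n, hn⟩ := ENat.ne_top_iff_exists.mp (hfin v)
  have hpath : M.HasPath n s₀ v := by
    by_contra hno
    have : ((n + 1 : ℕ) : ℕ∞) ≤ M.dist s₀ v := by
      refine le_iInf₂ fun T hT => ?_
      have h1 : M.dist s₀ v ≤ T := iInf₂_le T hT
      rw [← hn] at h1
      have h2 : n ≤ T := by exact_mod_cast h1
      have h3 : n ≠ T := fun e => hno (e ▸ hT)
      exact_mod_cast (by omega : n + 1 ≤ T)
    rw [← hn] at this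
    have : n + 1 ≤ n := by exact_mod_cast this
    omega
  obtain ⟨x, hx0, hxn, hx⟩ := hpath
  cases n with
  | zero => exact absurd (hxn.symm.trans hx0) hv
  | succ n =>
    have hedge := hx n (Nat.lt_succ_self n)
    rw [hxn] at hedge
    refine ⟨x n, hedge, le_antisymm ?_ ?_⟩
    · obtain ⟨m, hm⟩ := ENat.ne_top_iff_exists.mp (hfin (x n))
      -- A path to `x n` extends by one edge to a path to `v`.
      rw [MDP.dist, MDP.dist, ENat.iInf_add]
      refine le_iInf fun T => ?_
      rw [ENat.iInf_add]
      refine le_iInf fun hT => ?_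
      obtain ⟨y, hy0, hyT, hy⟩ := hT
      refine iInf₂_le_of_le (T + 1)
        ⟨fun t => if t ≤ T then y t else v, by simp [hy0], by simp, fun t ht => ?_⟩ (by simp)
      rcases Nat.lt_or_ge t T with h | h
      · simp only [if_pos h.le, if_pos (Nat.succ_le_of_lt h)]
        exact hy t h
      · have : t = T := by omega
        subst this
        simpa [hyT] using hedge
    · rw [← hn]
      have : M.dist s₀ (x n) ≤ n :=
        iInf₂_le n ⟨x, hx0, rfl, fun t ht => hx t (ht.trans (Nat.lt_succ_self n))⟩
      push_cast
      gcongr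

lemma nonempty_navTeach [Fintype S] (L : QLearner S A) {D : ℕ} (hM : M.diameter = (D : ℕ∞))
    {s₀ : S} (hμ : M.μ₀ = PMF.pure s₀) : Nonempty (NavTeach M L) := by
  classical
  have hle := dist_le_of_diameter hM hμ
  have hfin : ∀ v, M.dist s₀ v ≠ ⊤ := fun v => ne_top_of_le_ne_top (ENat.natCast_ne_top D) (hle v)
  choose f hf using exists_bfs_parent hfin
  set parent : S → S := fun v => if hv : v = s₀ then s₀ else f v hv with hpar
  have hp : ∀ v (hv : v ≠ s₀), parent v = f v hv := fun v hv => dif_neg hv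
  have hdist : ∀ v, v ≠ s₀ → M.dist s₀ v = M.dist s₀ (parent v) + 1 := fun v hv => by
    rw [hp v hv]
    exact (hf v hv).2
  obtain ⟨order, horder⟩ := exists_isPostOrder (parent := parent) (root := s₀)
    (depth := fun v => (M.dist s₀ v).toNat) (D := D)
    (fun v hv => by
      rw [hdist v hv, ENat.toNat_add (hfin _) (by simp)]
      rfl)
    (fun v => ENat.toNat_le_of_le_natCast (hle v)) s₀
  choose r hr using L.controllable
  exact ⟨{
    root := s₀
    root_mem := by simp [hμ, PMF.pure_apply]
    root_min := fun s hs => by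
      rw [hμ, PMF.pure_apply] at hs
      by_cases he : s = s₀
      · rw [he]
      · simp [he] at hs
    parent := parent
    parent_root := dif_pos rfl
    parent_edge := fun v hv => by
      rw [hp v hv]
      exact (hf v hv).1
    parent_dist := hdist
    order := order
    order_post := horder
    carrotStick := r
    carrotStick_spec := hr }⟩

lemma pMin_le {s : S} {a : A} {s' : S} (h : 0 < M.P s a s') : M.pMin ≤ M.P s a s' :=
  iInf_le_of_le s (iInf_le_of_le a (iInf₂_le s' h))

lemma pMin_le_one (s : S) (a : A) : M.pMin ≤ 1 := by
  obtain ⟨s', hs'⟩ := (M.P s a).support_nonempty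
  exact (pMin_le (pos_iff_ne_zero.mpr hs')).trans ((M.P s a).coe_le_one s')

end Existence

lemma navTeach_expectedSteps_le {S : Type*} {A : Type*} [Fintype S] [Fintype A] {L : QLearner S A}
    {M : MDP S A} {D : ℕ} (hH : D < M.H) (hM : M.diameter = (D : ℕ∞)) {s₀ : S}
    (hμ : M.μ₀ = PMF.pure s₀) (N : NavTeach M L) (Q₀ : QTable S A) (π : S → A)
    (htie : (L.ε : ℝ) ≤ 1 - 1 / (Fintype.card A : ℝ) ∨ ∀ s, Function.Injective (Q₀ s)) :
    expectedSteps M L Q₀ π (N.teacher Q₀ π) ≤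
      ((4 : ℝ≥0) : ℝ≥0∞) * Fintype.card S * Fintype.card A * M.H *
        (1 / (M.pMin * (1 - (L.ε : ℝ≥0∞)))) ^ D := by
  have hroot := N.root_eq hμ
  subst hroot
  have hle := dist_le_of_diameter hM hμ
  have hfin : ∀ v, M.dist N.root v ≠ ⊤ := fun v => ne_top_of_le_ne_top (ENat.natCast_ne_top D) (hle v)
  have hp1 := pMin_le_one (M := M) N.root (π N.root)
  have hε1 : (1 : ℝ≥0∞) - L.ε ≤ 1 := tsub_le_self
  set e : ℝ≥0∞ := M.pMin * (1 - (L.ε : ℝ≥0∞)) with he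
  have he1 : e ≤ 1 := mul_le_one' hp1 hε1
  have hetop : e ≠ ⊤ := ne_top_of_le_ne_top ENNReal.one_ne_top he1
  by_cases h0 : e ^ D = 0
  · -- The bound is infinite.
    have hinf : (1 / e) ^ D = ⊤ := by
      rw [one_div, ← ENNReal.inv_pow, h0, ENNReal.inv_zero]
    rw [hinf, ENNReal.mul_top]
    · exact le_top
    · have hS : (Fintype.card S : ℝ≥0∞) ≠ 0 := by
        exact_mod_cast (Fintype.card_pos_iff.mpr ⟨N.root⟩).ne'
      have hA : (Fintype.card A : ℝ≥0∞) ≠ 0 := by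
        exact_mod_cast (Fintype.card_pos_iff.mpr ⟨π N.root⟩).ne'
      have hH0 : (M.H : ℝ≥0∞) ≠ 0 := by exact_mod_cast (show M.H ≠ 0 by omega)
      exact mul_ne_zero (mul_ne_zero (mul_ne_zero (by simp) hS) hA) hH0
  · have hpos : 0 < e.toReal ^ D := by
      rw [← ENNReal.toReal_pow]
      exact ENNReal.toReal_pos h0 (ENNReal.pow_ne_top hetop)
    have h1ε : ((1 : ℝ≥0∞) - L.ε).toReal = 1 - L.ε := by
      rw [ENNReal.toReal_sub_of_le (by exact_mod_cast L.ε_le_one) ENNReal.one_ne_top]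
      simp
    have hεR : (L.ε : ℝ) ≤ 1 := by exact_mod_cast L.ε_le_one
    refine (NavTeach.expectedSteps_le (q := e.toReal) hfin hH hμ
      (fun v => ENat.toNat_le_of_le_natCast (hle v)) ENNReal.toReal_nonneg
      (ENNReal.toReal_le_of_le_ofReal zero_le_one (by simpa using he1)) hpos
      (fun s a s' hP => ?_) htie).trans (le_of_eq ?_)
    · rw [he, ENNReal.toReal_mul, h1ε, mul_comm]
      exact mul_le_mul_of_nonneg_left
        (ENNReal.toReal_mono ((M.P s a).apply_ne_top s') (pMin_le hP)) (by linarith)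
    · rw [ENNReal.ofReal_mul (by positivity), ENNReal.ofReal_inv_of_pos hpos,
        ENNReal.ofReal_pow ENNReal.toReal_nonneg, ENNReal.ofReal_toReal hetop, one_div,
        ENNReal.inv_pow]
      congr 1
      rw [ENNReal.ofReal_mul (by positivity), ENNReal.ofReal_mul (by positivity),
        ENNReal.ofReal_mul (by positivity)]
      simp

theorem theorem6 :
    ∃ C : ℝ≥0, ∀ (S : Type*) (A : Type*) [Fintype S] [Fintype A] (L : QLearner S A)
      (𝓜 : Set (MDP S A)) (H D : ℕ) (p : ℝ≥0∞),
      D < H →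
      (∀ M ∈ 𝓜, M.H = H ∧ M.diameter = (D : ℕ∞) ∧ M.pMin = p ∧ ∃ s₀, M.μ₀ = PMF.pure s₀) →
      (∀ M ∈ 𝓜,
        Nonempty (NavTeach M L) ∧
        ∀ (N : NavTeach M L) (Q₀ : QTable S A) (π : S → A),
          ((L.ε : ℝ) ≤ 1 - 1 / (Fintype.card A : ℝ) ∨ ∀ s, Function.Injective (Q₀ s)) →
          expectedSteps M L Q₀ π (N.teacher Q₀ π) ≤
            C * Fintype.card S * Fintype.card A * H * (1 / (p * (1 - (L.ε : ℝ≥0∞)))) ^ D) ∧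
      ((L.ε : ℝ) ≤ 1 - 1 / (Fintype.card A : ℝ) →
        TDim L 𝓜 ≤
          C * Fintype.card S * Fintype.card A * H * (1 / (p * (1 - (L.ε : ℝ≥0∞)))) ^ D) := by
  refine ⟨4, fun S A _ _ L 𝓜 H D p hDH h𝓜 => ?_⟩
  have main : ∀ M ∈ 𝓜, Nonempty (NavTeach M L) ∧
      ∀ (N : NavTeach M L) (Q₀ : QTable S A) (π : S → A),
        ((L.ε : ℝ) ≤ 1 - 1 / (Fintype.card A : ℝ) ∨ ∀ s, Function.Injective (Q₀ s)) →
        expectedSteps M L Q₀ π (N.teacher Q₀ π) ≤ ((4 : ℝ≥0) : ℝ≥0∞) * Fintype.card S *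
          Fintype.card A * H * (1 / (p * (1 - (L.ε : ℝ≥0∞)))) ^ D := by
    intro M hM
    obtain ⟨rfl, hdiam, rfl, s₀, hμ⟩ := h𝓜 M hM
    exact ⟨nonempty_navTeach L hdiam hμ, fun N Q₀ π htie =>
      navTeach_expectedSteps_le hDH hdiam hμ N Q₀ π htie⟩
  refine ⟨main, fun hε => iSup₂_le fun M hM => iSup₂_le fun Q₀ π => ?_⟩
  obtain ⟨⟨N⟩, hN⟩ := main M hM
  exact (iInf_le _ (N.teacher Q₀ π)).trans (hN N Q₀ π (.inl hε))
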